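/- Let $0<\alpha<1$. There is a constant $K>0$ depending only on $\alpha$ such that the following holds. Let $d\in\mathbb N$, let $I_1,\dots,I_d$ be (finite or infinite) index sets, and let $A_i$ be a positive definite self-adjoint, possibly unbounded, operator on $\ell^2(I_i)$ over $\mathbb C$ (for $I_i=\{1,\dots,n_i\}$: a Hermitian positive definite $n_i\times n_i$ matrix), where positive definite means $\langle A_iv,v\rangle>0$ for every $v\neq 0$ in the domain of $A_i$. Let $$\mathcal A=\bigoplus_{i=1}^d A_i=\sum_{i=1}^d I\otimes\cdots\otimes A_i\otimes\cdots\otimes I$$ be their Kronecker sum on $\ell^2(I_1\times\cdots\times I_d)$, i.e. the closure of the operator defined by this formula on the span of the elementary tensors $v_1\otimes\cdots\otimes v_d$ with $v_i$ in the domain of $A_i$. Assume that $\mathcal A$ is invertible, i.e. has a bounded everywhere defined inverse, and put $\mathcal A^{-\alpha}=(\mathcal A^{-1})^{\alpha}$. Let $C\in\ell^2(I_1\times\cdots\times I_d)$ be a tensor, with Frobenius norm $\|C\|_F$ and vectorization $c=\mathrm{vec}(C)$, and let $X$ be the tensor with $\mathrm{vec}(X)=x=\mathcal A^{-\alpha}c$.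 Then for every $N\in\mathbb N$ there is a tensor $X_N$ with $$\|X-X_N\|_F\le K\,\|\mathcal A^{-1}\|^{\alpha}\,\|C\|_F\,e^{-\frac{\pi}{2}\sqrt{\alpha N}}$$ (in particular $\|X-X_N\|_F=O(e^{-\frac{\pi}{2}\sqrt{\alpha N}})$ as $N\to\infty$; note $\|\mathcal A^{-1}\|=\lambda_{\min}^{-1}$, with $\lambda_{\min}>0$ the minimum of the spectrum of $\mathcal A$, unless the space is zero), and such that - if $C$ has CP rank at most $r$, then $X_N$ has CP rank at most $Nr$; - if $C$ has multilinear rank at most $(r_1,\dots,r_d)$ componentwise, then $X_N$ has multilinear rank at most $(Nr_1,\dots,Nr_d)$; - if $C$ has TT-ranks at most $(r_1,\dots,r_{d-1})$ componentwise, then $X_N$ has TT-ranks at most $(Nr_1,\dots,Nr_{d-1})$. Here the CP rank of a tensor is the least number of elementary tensors $u_1\otimes\cdots\otimes u_d$, $u_i\in\ell^2(I_i)$, that sum to it; the $i$-th entry of the multilinear rank is the rank of the matrix with row index the $i$-th tensor index and column index all the others; and the $k$-th TT-rank is the rank of the matrix whose row index is formed by the first $k$ tensor indices and whose column index is formed by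 the remaining ones. -/

import Mathlib

open scoped InnerProductSpace ENNReal

universe u

noncomputable section

namespace FracKron

/-- The Hilbert space `ℓ²(κ)` of complex square-summable families indexed by `κ`.
For `κ = Fin n` this is `ℂⁿ` with the Euclidean norm; since every complex Hilbert space has an
orthonormal basis, every complex Hilbert space is of this form up to a unitary. -/
abbrev Ell2 (κ : Type u) : Type u := lp (fun _ : κ => ℂ) 2

/-- Tensors with `d` modes, the `i`-th index running through `ι i` (for `ι i = Fin (n i)`:
arrays of size `n₁ × ⋯ × n_d`), with the Frobenius norm. A tensor and its vectorization
are the same family of numbers indexed by the tuples `(p₁, …, p_d)`. -/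
abbrev Tensor {d : ℕ} (ι : Fin d → Type u) : Type u := Ell2 (∀ i, ι i)

variable {d : ℕ} {ι : Fin d → Type u}

theorem memℓp_prod (v : ∀ i, Ell2 (ι i)) :
    Memℓp (fun p : ∀ i, ι i => ∏ i, v i (p i)) 2 := by
  classical
  have hs : ∀ i, Summable fun k => ‖v i k‖ ^ 2 := fun i => by
    have := (lp.memℓp (v i)).summable (by norm_num)
    simpa using this
  refine memℓp_gen' (C := ∏ i, ∑' k, ‖v i k‖ ^ 2) fun s => ?_
  calc ∑ p ∈ s, ‖∏ i, v i (p i)‖ ^ (2 : ℝ≥0∞).toReal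
      = ∑ p ∈ s, ∏ i, ‖v i (p i)‖ ^ 2 := by
        simp [norm_prod, Finset.prod_pow]
    _ ≤ ∑ p ∈ Fintype.piFinset fun i => s.image fun p => p i, ∏ i, ‖v i (p i)‖ ^ 2 := by
        refine Finset.sum_le_sum_of_subset_of_nonneg (fun p hp => ?_) fun _ _ _ => by positivity
        exact Fintype.mem_piFinset.2 fun i => Finset.mem_image_of_mem _ hp
    _ = ∏ i, ∑ k ∈ s.image fun p => p i, ‖v i k‖ ^ 2 := by
        rw [Finset.prod_univ_sum]
    _ ≤ ∏ i, ∑' k, ‖v i k‖ ^ 2 :=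
        Finset.prod_le_prod (fun _ _ => Finset.sum_nonneg fun _ _ => by positivity)
          fun i _ => (hs i).sum_le_tsum _ fun _ _ => by positivity

/-- The elementary tensor `v₁ ⊗ ⋯ ⊗ v_d`. -/
def elem (v : ∀ i, Ell2 (ι i)) : Tensor ι :=
  ⟨fun p => ∏ i, v i (p i), memℓp_prod v⟩

/-! ### Kronecker sums of (possibly unbounded) operators -/

/-- The graph of the Kronecker sum on the algebraic tensor product of the domains: the span of
the pairs `(v₁ ⊗ ⋯ ⊗ v_d, ∑ j, v₁ ⊗ ⋯ ⊗ A_j v_j ⊗ ⋯ ⊗ v_d)` with `v_i` in the domain of `A_i`. -/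
def algKroneckerGraph (A : ∀ i, Ell2 (ι i) →ₗ.[ℂ] Ell2 (ι i)) :
    Submodule ℂ (Tensor ι × Tensor ι) :=
  Submodule.span ℂ <| Set.range fun v : ∀ i, (A i).domain =>
    (elem fun i => (v i : Ell2 (ι i)),
      ∑ j, elem (Function.update (fun i => (v i : Ell2 (ι i))) j (A j (v j))))

/-- The Kronecker sum `A₁ ⊕ ⋯ ⊕ A_d = ∑ j, I ⊗ ⋯ ⊗ A_j ⊗ ⋯ ⊗ I`: the closure of the operator
that is defined on the algebraic tensor product of the domains. For self-adjoint `A_i` that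
operator is densely defined and symmetric, hence closable, so the closure of its graph is
the graph of an operator. -/
def kroneckerSum (A : ∀ i, Ell2 (ι i) →ₗ.[ℂ] Ell2 (ι i)) : Tensor ι →ₗ.[ℂ] Tensor ι :=
  (algKroneckerGraph A).topologicalClosure.toLinearPMap

/-- `A` is symmetric positive definite: self-adjoint (in particular densely defined), with
`⟪A v, v⟫ > 0` for all nonzero `v` in its domain. -/
def IsSPD {H : Type u} [NormedAddCommGroup H] [InnerProductSpace ℂ H] [CompleteSpace H]
    (A : H →ₗ.[ℂ] H) : Prop :=
  IsSelfAdjoint A ∧ ∀ v : A.domain, (v : H) ≠ 0 → 0 < (⟪A v, (v : H)⟫_ℂ).re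

/-! ### Inverses and negative fractional powers -/

section Powers

variable {H : Type u} [NormedAddCommGroup H] [InnerProductSpace ℂ H] [CompleteSpace H]

/-- `B` is a bounded two-sided inverse of the operator `T`. -/
def IsBoundedInverse (T : H →ₗ.[ℂ] H) (B : H →L[ℂ] H) : Prop :=
  (∀ y : H, ∃ h : B y ∈ T.domain, T ⟨B y, h⟩ = y) ∧ ∀ x : T.domain, B (T x) = x

/-- `T` is invertible: `0` lies in its resolvent set. -/
def IsInvertible (T : H →ₗ.[ℂ] H) : Prop := ∃ B : H →L[ℂ] H, IsBoundedInverse T B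

open Classical in
/-- The bounded inverse `T⁻¹` of an invertible operator (it is unique). -/
def boundedInverse (T : H →ₗ.[ℂ] H) : H →L[ℂ] H :=
  if h : IsInvertible T then h.choose else 0

/-- `T^{-α} = (T⁻¹)^α` for an invertible positive self-adjoint `T` and `α > 0`; the power of
the bounded positive operator `T⁻¹` is given by the continuous functional calculus. If `T ≥ 0` has spectrum with minimum `λ`, then
`‖T⁻¹‖ = 1 / λ`. -/
def negPow (T : H →ₗ.[ℂ] H) (α : ℝ) : H →L[ℂ] H := boundedInverse T ^ α

end Powers

/-! ### Tensor ranks -/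

/-- The CP rank: the least number of terms in a representation as a sum of elementary
tensors, and `⊤` if there is none. -/
def cpRank (X : Tensor ι) : ℕ∞ :=
  ⨅ (k : ℕ) (_ : ∃ v : Fin k → ∀ i, Ell2 (ι i), X = ∑ s, elem (v s)), (k : ℕ∞)

/-- The `i`-th mode unfolding: the matrix whose row index is the `i`-th index of the tensor and
whose column index collects all the others. -/
def modeUnfolding (X : Tensor ι) (i : Fin d) :
    Matrix (ι i) (∀ j : {j // j ≠ i}, ι j) ℂ :=
  fun a q => X ((Equiv.piSplitAt i ι).symm (a, q))

/-- The multilinear rank: the ranks of the `d` mode unfoldings. -/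
def multilinearRank (X : Tensor ι) (i : Fin d) : ℕ∞ := (modeUnfolding X i).eRank

/-- The matricization that groups the first `k` indices as row index and the remaining
ones as column index. -/
def ttUnfolding (X : Tensor ι) (k : ℕ) :
    Matrix (∀ j : {j : Fin d // j.val < k}, ι j) (∀ j : {j : Fin d // ¬ j.val < k}, ι j) ℂ :=
  fun a q => X ((Equiv.piEquivPiSubtypeProd (fun j : Fin d => j.val < k) ι).symm (a, q))

/-- The TT-ranks `(r₁, …, r_{d-1})`; the entry with index `k : Fin (d - 1)` belongs to the
matricization with `k + 1` row indices. -/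
def ttRank (X : Tensor ι) (k : Fin (d - 1)) : ℕ∞ := (ttUnfolding X (k.val + 1)).eRank

end FracKron

end

/-!
Substituting `t = exp (-x)` in Euler's integral `l ^ (-α) * Γ(α) = ∫ t ^ (α - 1) * exp (-t l) dt`
and applying the trapezoidal rule with `N` nodes gives an exponential sum
`∑ k, w k * exp (-(t k) l)` that approximates `l ^ (-α)` uniformly for `l ≥ 1`. By Poisson summation
the discretization error is governed by the decay `exp (-(π / 4) |Im s|)` of `Γ(s)` on vertical
lines, which yields the rate `exp (-(π / 2) √(α N))`. Since
`exp (-t 𝒜) = exp (-t A₁) ⊗ ⋯ ⊗ exp (-t A_d)` maps simple tensors to simple tensors, each rank of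
`∑ k, w k • exp (-(t k) 𝒜) C` is at most `N` times that of `C`.

For unbounded `A_i` the identity for `exp (-t 𝒜)` is stated in terms of `B = 𝒜⁻¹` and the resolvents
`R i = (1 + A_i)⁻¹`. These are commuting bounded operators, and `χ(B)⁻¹ = ∑ i, (χ(R i)⁻¹ - 1)` for
every character `χ` of the C⋆-algebra they generate that does not vanish at `∏ i, R i`. These
characters suffice, because `∏ i, R i` is injective.
-/

noncomputable section

namespace FracKron

section GammaDecay

open MeasureTheory

lemma integrableOn_rpow_mul_exp_neg_mul {σ x : ℝ} (hσ : -1 < σ) (hx : 0 < x) :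
    IntegrableOn (fun t : ℝ => t ^ σ * Real.exp (-(x * t))) (Set.Ioi 0) := by
  simpa using integrableOn_rpow_mul_exp_neg_mul_rpow hσ one_pos hx

lemma norm_cpow_mul_exp_neg_mul (s r : ℂ) {t : ℝ} (ht : 0 < t) :
    ‖(t : ℂ) ^ s * Complex.exp (-(r * t))‖ = t ^ s.re * Real.exp (-(r.re * t)) := by
  rw [norm_mul, Complex.norm_cpow_eq_rpow_re_of_pos ht, Complex.norm_exp]
  simp

lemma aestronglyMeasurable_cpow_mul_exp_neg_mul (s r : ℂ) :
    AEStronglyMeasurable (fun t : ℝ => (t : ℂ) ^ s * Complex.exp (-(r * t)))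
      (volume.restrict (Set.Ioi 0)) := by
  refine ContinuousOn.aestronglyMeasurable (fun t ht => ?_) measurableSet_Ioi
  have ht' : (t : ℂ) ∈ Complex.slitPlane := Complex.ofReal_mem_slitPlane.2 ht
  exact ((Complex.continuous_ofReal.continuousAt.cpow continuousAt_const ht').mul
    (by fun_prop)).continuousWithinAt

lemma integrableOn_cpow_mul_exp_neg_mul {s r : ℂ} (hs : -1 < s.re) (hr : 0 < r.re) :
    IntegrableOn (fun t : ℝ => (t : ℂ) ^ s * Complex.exp (-(r * t))) (Set.Ioi 0) :=
  (integrableOn_rpow_mul_exp_neg_mul hs hr).mono'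
    (aestronglyMeasurable_cpow_mul_exp_neg_mul s r)
    ((ae_restrict_mem measurableSet_Ioi).mono fun _ ht => (norm_cpow_mul_exp_neg_mul s r ht).le)

lemma differentiableAt_integral_cpow_mul_exp_neg_mul {s r : ℂ} (hs : -1 < s.re) (hr : 0 < r.re) :
    DifferentiableAt ℂ
      (fun z : ℂ => ∫ t : ℝ in Set.Ioi 0, (t : ℂ) ^ s * Complex.exp (-(z * t))) r := by
  have hnhds : {z : ℂ | r.re / 2 < z.re} ∈ nhds r :=
    (isOpen_lt continuous_const Complex.continuous_re).mem_nhds (half_lt_self hr)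
  have hderiv (t : ℝ) (z : ℂ) : HasDerivAt (fun z : ℂ => (t : ℂ) ^ s * Complex.exp (-(z * t)))
      (-t * ((t : ℂ) ^ s * Complex.exp (-(z * t)))) z := by
    refine ((((hasDerivAt_id z).mul_const (t : ℂ)).neg.cexp).const_mul ((t : ℂ) ^ s)).congr_deriv ?_
    simp only [Pi.neg_apply, id_eq]
    ring
  have hbound (t : ℝ) (ht : 0 < t) (z : ℂ) (hz : r.re / 2 < z.re) :
      ‖-t * ((t : ℂ) ^ s * Complex.exp (-(z * t)))‖ ≤
        t ^ (s.re + 1) * Real.exp (-(r.re / 2 * t)) := by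
    rw [norm_mul, norm_cpow_mul_exp_neg_mul s z ht, norm_neg, Complex.norm_real,
      Real.norm_of_nonneg ht.le, Real.rpow_add_one ht.ne', ← mul_assoc, mul_comm t]
    gcongr
  exact (hasDerivAt_integral_of_dominated_loc_of_deriv_le hnhds
    (.of_forall fun z => aestronglyMeasurable_cpow_mul_exp_neg_mul s z)
    (integrableOn_cpow_mul_exp_neg_mul hs hr)
    (Complex.continuous_ofReal.neg.aestronglyMeasurable.mul
      (aestronglyMeasurable_cpow_mul_exp_neg_mul s r))
    ((ae_restrict_mem measurableSet_Ioi).mono hbound)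
    (integrableOn_rpow_mul_exp_neg_mul (by linarith) (half_pos hr))
    (.of_forall fun t z _ => hderiv t z)).2.differentiableAt

lemma integral_cpow_mul_exp_neg_mul_Ioi_of_re_pos {s r : ℂ} (hs : 0 < s.re) (hr : 0 < r.re) :
    ∫ t : ℝ in Set.Ioi 0, (t : ℂ) ^ (s - 1) * Complex.exp (-(r * t)) =
      (1 / r) ^ s * Complex.Gamma s := by
  let U : Set ℂ := {z | 0 < z.re}
  have hU : IsOpen U := isOpen_lt continuous_const Complex.continuous_re
  have hs' : -1 < (s - 1).re := by simpa using hs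
  have hleft : AnalyticOnNhd ℂ
      (fun z : ℂ => ∫ t : ℝ in Set.Ioi 0, (t : ℂ) ^ (s - 1) * Complex.exp (-(z * t))) U :=
    DifferentiableOn.analyticOnNhd (fun z hz =>
      (differentiableAt_integral_cpow_mul_exp_neg_mul hs' hz).differentiableWithinAt) hU
  have hright : AnalyticOnNhd ℂ (fun z : ℂ => (1 / z) ^ s * Complex.Gamma s) U := by
    refine DifferentiableOn.analyticOnNhd (fun z hz => ?_) hU
    have hz₀ : z ≠ 0 := fun h => by simp [U, h] at hz
    have hinv : 1 / z ∈ Complex.slitPlane := by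
      refine Or.inl ?_
      rw [one_div, Complex.inv_re]
      exact div_pos hz (Complex.normSq_pos.2 hz₀)
    exact ((DifferentiableAt.cpow_const (by fun_prop (disch := exact hz₀)) hinv).mul_const
      _).differentiableWithinAt
  have hreal : ∃ᶠ z in nhdsWithin (1 : ℂ) {1}ᶜ,
      ∫ t : ℝ in Set.Ioi 0, (t : ℂ) ^ (s - 1) * Complex.exp (-(z * t)) =
        (1 / z) ^ s * Complex.Gamma s := by
    have htendsto : Filter.Tendsto (fun x : ℝ => (x : ℂ)) (nhdsWithin 1 {1}ᶜ)
        (nhdsWithin 1 {1}ᶜ) := by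
      refine tendsto_nhdsWithin_iff.2 ⟨?_, ?_⟩
      · exact (Complex.continuous_ofReal.tendsto' 1 1 Complex.ofReal_one).mono_left
          nhdsWithin_le_nhds
      · filter_upwards [self_mem_nhdsWithin] with x hx using by simpa using hx
    refine htendsto.frequently (Filter.Eventually.frequently ?_)
    filter_upwards [nhdsWithin_le_nhds (lt_mem_nhds one_pos)] with x hx
    exact Complex.integral_cpow_mul_exp_neg_mul_Ioi hs hx
  exact hleft.eqOn_of_preconnected_of_frequently_eq hright
    (convex_halfSpace_re_gt 0).isPreconnected (z₀ := 1) (by simp [U]) hreal hr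

-- Rotating the line of integration in Euler's integral by the angle `φ` trades the factor
-- `(cos φ)⁻¹ ^ s.re` for exponential decay in the imaginary direction.
lemma norm_Gamma_le_of_abs_lt_pi_div_two {s : ℂ} (hs : 0 < s.re) {φ : ℝ} (hφ : |φ| < Real.pi / 2) :
    ‖Complex.Gamma s‖ ≤ (1 / Real.cos φ) ^ s.re * Real.Gamma s.re * Real.exp (-(φ * s.im)) := by
  have hcos : 0 < Real.cos φ := Real.cos_pos_of_mem_Ioo (abs_lt.1 hφ)
  set r : ℂ := Complex.exp (φ * Complex.I) with hr
  have hre : r.re = Real.cos φ := Complex.exp_ofReal_mul_I_re φ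
  have hcpow : ‖(1 / r) ^ s‖ = Real.exp (φ * s.im) := by
    have him : (-(φ * Complex.I) : ℂ).im = -φ := by simp
    have hlog : Complex.log (1 / r) = -(φ * Complex.I) := by
      rw [one_div, hr, ← Complex.exp_neg, Complex.log_exp] <;> rw [him] <;>
        linarith [abs_lt.1 hφ, Real.pi_pos]
    rw [Complex.cpow_def_of_ne_zero (by simp [hr]), hlog, Complex.norm_exp]
    simp
  have hrot : ‖(1 / r) ^ s * Complex.Gamma s‖ ≤ (1 / Real.cos φ) ^ s.re * Real.Gamma s.re := by
    rw [← integral_cpow_mul_exp_neg_mul_Ioi_of_re_pos hs (hre ▸ hcos),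
      ← Real.integral_rpow_mul_exp_neg_mul_Ioi hs hcos]
    refine (norm_integral_le_integral_norm _).trans_eq
      (setIntegral_congr_fun measurableSet_Ioi fun t ht => ?_)
    simpa [hre] using norm_cpow_mul_exp_neg_mul (s - 1) r ht
  rw [norm_mul, hcpow] at hrot
  rwa [Real.exp_neg, ← div_eq_mul_inv, le_div_iff₀' (Real.exp_pos _)]

lemma norm_Gamma_le_exp_neg_abs_im {s : ℂ} (hs : 0 < s.re) :
    ‖Complex.Gamma s‖ ≤ √2 ^ s.re * Real.Gamma s.re * Real.exp (-(Real.pi / 4 * |s.im|)) := by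
  have hcos : 1 / Real.cos (Real.pi / 4) = √2 := by
    rw [Real.cos_pi_div_four, one_div_div, Real.div_sqrt]
  have hπ : |Real.pi / 4| < Real.pi / 2 := by
    rw [abs_of_pos] <;> linarith [Real.pi_pos]
  rcases abs_cases s.im with ⟨him, -⟩ | ⟨him, -⟩ <;> rw [him, ← hcos]
  · exact norm_Gamma_le_of_abs_lt_pi_div_two hs hπ
  · simpa using norm_Gamma_le_of_abs_lt_pi_div_two hs ((abs_neg _).trans_lt hπ)

end GammaDecay

section Trapezoidal

open Filter Asymptotics MeasureTheory FourierTransform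

lemma hasSum_exp_neg_mul {c : ℝ} (hc : 0 < c) :
    HasSum (fun k : ℕ => Real.exp (-(c * k))) (1 - Real.exp (-c))⁻¹ := by
  convert! hasSum_geometric_of_lt_one (Real.exp_pos (-c)).le (by simpa using hc) with k
  rw [← Real.exp_nat_mul, mul_neg, mul_comm]

lemma inv_one_sub_exp_neg_le {c : ℝ} (hc : 0 < c) : (1 - Real.exp (-c))⁻¹ ≤ 1 + 1 / c := by
  have hexp : Real.exp (-c) * (1 + c) ≤ 1 := by
    rw [Real.exp_neg, inv_mul_le_one₀ (Real.exp_pos c)]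
    linarith [Real.add_one_le_exp c]
  have hpos : 0 < 1 - Real.exp (-c) := sub_pos.2 (by simpa using hc)
  rw [inv_le_iff_one_le_mul₀ hpos, one_add_div hc.ne', div_mul_eq_mul_div, le_div_iff₀ hc]
  linarith

lemma summable_and_norm_tsum_int_sub_sum_range_le {E : Type*} [NormedAddCommGroup E]
    [CompleteSpace E] {f : ℤ → E} {C c : ℝ} (hc : 0 < c) (N : ℕ)
    (hright : ∀ k : ℕ, ‖f (N + k)‖ ≤ C * Real.exp (-(c * k)))
    (hleft : ∀ k : ℕ, ‖f (-(k + 1))‖ ≤ C * Real.exp (-(c * k))) :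
    Summable f ∧ ‖∑' n, f n - ∑ k ∈ Finset.range N, f k‖ ≤ 2 * C * (1 + 1 / c) := by
  have hgeom := (hasSum_exp_neg_mul hc).mul_left C
  have hC : 0 ≤ C := by simpa using (norm_nonneg _).trans (hleft 0)
  have hshift (k : ℕ) : f ((k + N : ℕ) : ℤ) = f (N + k) := by rw [Nat.cast_add, add_comm]
  have hnat : Summable fun k : ℕ => f k := by
    rw [← summable_nat_add_iff N]
    simpa only [hshift] using hgeom.summable.of_norm_bounded hright
  have hsum := hnat.hasSum.of_nat_of_neg_add_one (hgeom.summable.of_norm_bounded hleft).hasSum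
  refine ⟨hsum.summable, ?_⟩
  rw [hsum.tsum_eq, ← hnat.sum_add_tsum_nat_add N, add_assoc, add_sub_cancel_left]
  simp only [hshift]
  calc ‖(∑' k : ℕ, f (N + k)) + ∑' k : ℕ, f (-(k + 1))‖
      ≤ C * (1 - Real.exp (-c))⁻¹ + C * (1 - Real.exp (-c))⁻¹ :=
        (norm_add_le _ _).trans
          (add_le_add (tsum_of_norm_bounded hgeom hright) (tsum_of_norm_bounded hgeom hleft))
    _ = 2 * C * (1 - Real.exp (-c))⁻¹ := by ring
    _ ≤ 2 * C * (1 + 1 / c) := by gcongr; exact inv_one_sub_exp_neg_le hc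

lemma fourier_comp_mul_left {E : Type*} [NormedAddCommGroup E] [NormedSpace ℂ E] (f : ℝ → E)
    {h : ℝ} (hh : 0 < h) (w : ℝ) : 𝓕 (fun x => f (h * x)) w = h⁻¹ • 𝓕 f (w / h) := by
  have hsubst := Measure.integral_comp_mul_left
    (fun v : ℝ => Complex.exp (↑(-2 * Real.pi * v * (w / h)) * Complex.I) • f v) h
  rw [abs_of_pos (inv_pos.2 hh)] at hsubst
  rw [Real.fourier_real_eq_integral_exp_smul, Real.fourier_real_eq_integral_exp_smul, ← hsubst]
  congr! 6 with x
  field_simp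

lemma fourier_zero_eq_integral {E : Type*} [NormedAddCommGroup E] [NormedSpace ℂ E] (f : ℝ → E) :
    𝓕 f 0 = ∫ x, f x := by
  simp [Real.fourier_real_eq_integral_exp_smul]

lemma isBigO_exp_neg_mul_abs {c : ℝ} (hc : 0 < c) :
    (fun x : ℝ => Real.exp (-(c * |x|))) =O[cocompact ℝ] fun x : ℝ => |x| ^ (-(2 : ℝ)) := by
  have h := (isLittleO_exp_neg_mul_rpow_atTop hc (-2)).isBigO.comp_tendsto
    (tendsto_norm_cocompact_atTop (E := ℝ))
  simpa only [Function.comp_def, Real.norm_eq_abs, neg_mul] using h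

lemma norm_trapezoidal_sub_integral_le {f : ℝ → ℂ} (hf : Continuous f) {A a D b : ℝ} (ha : 0 < a)
    (hdecay : ∀ x, ‖f x‖ ≤ A * Real.exp (-(a * |x|))) (hb : 0 < b)
    (hfourier : ∀ w, ‖𝓕 f w‖ ≤ D * Real.exp (-(b * |w|))) {h : ℝ} (hh : 0 < h) :
    ‖h • ∑' n : ℤ, f (h * n) - ∫ x, f x‖ ≤ 2 * (D * Real.exp (-(b / h))) * (1 + h / b) := by
  let g : ℝ → ℂ := fun x => f (h * x)
  have hg : g =O[cocompact ℝ] fun x : ℝ => |x| ^ (-(2 : ℝ)) := by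
    refine (IsBigO.of_bound A (.of_forall fun x => ?_)).trans
      (isBigO_exp_neg_mul_abs (mul_pos ha hh))
    rw [Real.norm_of_nonneg (Real.exp_pos _).le]
    simpa only [g, abs_mul, abs_of_pos hh, mul_assoc] using hdecay (h * x)
  have hfourier_g (w : ℝ) : h • 𝓕 g w = 𝓕 f (w / h) := by
    rw [fourier_comp_mul_left f hh, smul_inv_smul₀ hh.ne']
  have htail (k : ℕ) (n : ℤ) (hn : |(n : ℝ)| = k + 1) :
      ‖h • 𝓕 g n‖ ≤ D * Real.exp (-(b / h)) * Real.exp (-(b / h * k)) := by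
    rw [hfourier_g, mul_assoc, ← Real.exp_add]
    refine (hfourier _).trans_eq ?_
    rw [abs_div, hn, abs_of_pos hh]
    ring_nf
  obtain ⟨hsummable, hle⟩ := summable_and_norm_tsum_int_sub_sum_range_le
    (f := fun n : ℤ => h • 𝓕 g n) (div_pos hb hh) 1
    (fun k => htail k _ (by push_cast; rw [abs_of_nonneg (by positivity), add_comm]))
    (fun k => htail k _ (by push_cast; rw [abs_neg, abs_of_nonneg (by positivity)]))
  have hpoisson : ∑' n : ℤ, g n = ∑' n : ℤ, 𝓕 g n := by
    simpa using Real.tsum_eq_tsum_fourier_of_rpow_decay_of_summable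
      (by fun_prop : Continuous g) one_lt_two hg
      (by simpa only [inv_smul_smul₀ hh.ne'] using hsummable.const_smul h⁻¹) 0
  have hzero : h • 𝓕 g 0 = ∫ x, f x := by
    rw [hfourier_g, zero_div, fourier_zero_eq_integral]
  rw [tsum_const_smul'' h, ← hpoisson] at hle
  simpa only [Finset.range_one, Finset.sum_singleton, Nat.cast_zero, Int.cast_zero, hzero,
    one_div_div] using hle

end Trapezoidal

section ExponentialSums

open FourierTransform

/-- The integrand of Euler's integral for `l ^ (-a) * Γ(a)` after the substitution
`t = exp (-x)`. Sampling it at equidistant points yields exponential sums in `l`. -/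
def eulerKernel (a l x : ℝ) : ℝ := Real.exp (-(a * x)) * Real.exp (-(l * Real.exp (-x)))

lemma eulerKernel_nonneg (a l x : ℝ) : 0 ≤ eulerKernel a l x := by
  unfold eulerKernel
  positivity

lemma fourier_eulerKernel {a l : ℝ} (ha : 0 < a) (hl : 0 < l) (w : ℝ) :
    𝓕 (fun x => (eulerKernel a l x : ℂ)) w =
      (1 / (l : ℂ)) ^ ((a : ℂ) + ↑(2 * Real.pi * w) * Complex.I) *
        Complex.Gamma (a + ↑(2 * Real.pi * w) * Complex.I) := by
  set s : ℂ := (a : ℂ) + ↑(2 * Real.pi * w) * Complex.I with hs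
  have hre : s.re = a := by simp [hs]
  have him : s.im / (2 * Real.pi) = w := by
    rw [hs, Complex.add_im, Complex.ofReal_im, Complex.im_ofReal_mul, Complex.I_im]
    field_simp
    ring
  rw [← Complex.integral_cpow_mul_exp_neg_mul_Ioi (hre ▸ ha) hl]
  have hmellin := mellin_eq_fourier (fun t : ℝ => Complex.exp (-(l * t))) (s := s)
  rw [hre, him] at hmellin
  refine Eq.trans (congrArg (fun f : ℝ → ℂ => 𝓕 f w) (funext fun x => ?_)) hmellin.symm
  simp [eulerKernel]

lemma eulerKernel_le (a : ℝ) {l : ℝ} (hl : 1 ≤ l) (x : ℝ) :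
    eulerKernel a l x ≤ Real.exp (2 * a ^ 2) * Real.exp (-(a * |x|)) := by
  rw [eulerKernel, ← Real.exp_add, ← Real.exp_add, Real.exp_le_exp]
  have hexp : Real.exp (-x) ≤ l * Real.exp (-x) := le_mul_of_one_le_left (Real.exp_pos _).le hl
  rcases le_total 0 x with hx | hx
  · rw [abs_of_nonneg hx]
    linarith [Real.exp_pos (-x), sq_nonneg a]
  · rw [abs_of_nonpos hx]
    have hquad := Real.quadratic_le_exp_of_nonneg (neg_nonneg.2 hx)
    nlinarith [sq_nonneg (2 * a + x)]

lemma norm_fourier_eulerKernel_le {a l : ℝ} (ha : 0 < a) (hl : 1 ≤ l) (w : ℝ) :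
    ‖𝓕 (fun x => (eulerKernel a l x : ℂ)) w‖ ≤
      √2 ^ a * Real.Gamma a * Real.exp (-(Real.pi ^ 2 / 2 * |w|)) := by
  have hl₀ : 0 < l := one_pos.trans_le hl
  rw [fourier_eulerKernel ha hl₀, norm_mul, one_div, ← Complex.ofReal_inv,
    Complex.norm_cpow_eq_rpow_re_of_pos (inv_pos.2 hl₀)]
  have hdecay := norm_Gamma_le_exp_neg_abs_im
    (s := a + ↑(2 * Real.pi * w) * Complex.I) (by simpa using ha)
  have hre : ((a : ℂ) + ↑(2 * Real.pi * w) * Complex.I).re = a := by simp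
  have him : Real.pi / 4 * |((a : ℂ) + ↑(2 * Real.pi * w) * Complex.I).im| =
      Real.pi ^ 2 / 2 * |w| := by
    rw [Complex.add_im, Complex.ofReal_im, Complex.im_ofReal_mul, Complex.I_im,
      mul_one, zero_add, abs_mul, abs_of_pos Real.two_pi_pos]
    ring
  rw [hre, him] at hdecay
  rw [hre]
  exact (mul_le_of_le_one_left (norm_nonneg _)
    (Real.rpow_le_one (by positivity) (inv_le_one_of_one_le₀ hl) ha.le)).trans hdecay

lemma integral_eulerKernel {a l : ℝ} (ha : 0 < a) (hl : 0 < l) :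
    ∫ x, (eulerKernel a l x : ℂ) = ↑(l ^ (-a) * Real.Gamma a) := by
  rw [← fourier_zero_eq_integral, fourier_eulerKernel ha hl, mul_zero, Complex.ofReal_zero,
    zero_mul, add_zero, Complex.ofReal_mul, Complex.Gamma_ofReal, one_div, ← Complex.ofReal_inv,
    ← Complex.ofReal_cpow (inv_pos.2 hl).le, Real.inv_rpow hl.le, Real.rpow_neg hl.le]

lemma abs_trapezoidal_eulerKernel_sub_le {a l h : ℝ} (ha : 0 < a) (hl : 1 ≤ l) (hh : 0 < h) :
    |h * ∑' n : ℤ, eulerKernel a l (h * n) - l ^ (-a) * Real.Gamma a| ≤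
      2 * (√2 ^ a * Real.Gamma a * Real.exp (-(Real.pi ^ 2 / 2 / h))) *
        (1 + h / (Real.pi ^ 2 / 2)) := by
  have hnorm (x : ℝ) : ‖(eulerKernel a l x : ℂ)‖ ≤
      Real.exp (2 * a ^ 2) * Real.exp (-(a * |x|)) := by
    rw [Complex.norm_of_nonneg (eulerKernel_nonneg a l x)]
    exact eulerKernel_le a hl x
  have hcont : Continuous fun x => (eulerKernel a l x : ℂ) := by
    unfold eulerKernel
    fun_prop
  have htrap := norm_trapezoidal_sub_integral_le hcont ha hnorm (by positivity)
    (norm_fourier_eulerKernel_le ha hl) hh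
  rwa [integral_eulerKernel ha (one_pos.trans_le hl), ← Complex.ofReal_tsum, Complex.real_smul,
    ← Complex.ofReal_mul, ← Complex.ofReal_sub, Complex.norm_real] at htrap

lemma abs_tsum_eulerKernel_sub_sum_range_le {a l h : ℝ} (ha : 0 < a) (hl : 1 ≤ l) (hh : 0 < h)
    (N : ℕ) :
    |∑' n : ℤ, eulerKernel a l (h * n) -
        ∑ k ∈ Finset.range N, eulerKernel a l (h * (k - (N / 2 : ℕ)))| ≤
      2 * (Real.exp (2 * a ^ 2) * Real.exp (-(a * h * (N / 2)))) * (1 + 1 / (a * h)) := by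
  set m : ℕ := N / 2
  have hm_le : (m : ℝ) ≤ N / 2 := Nat.cast_div_le
  have hle_m : (N : ℝ) / 2 ≤ m + 1 := by
    have : (N : ℝ) ≤ 2 * (m + 1) := by exact_mod_cast (by lia : N ≤ 2 * (m + 1))
    linarith
  have hdecay (n : ℤ) (k : ℕ) (hn : (N : ℝ) / 2 + k ≤ |((n - m : ℤ) : ℝ)|) :
      ‖eulerKernel a l (h * ((n - m : ℤ) : ℝ))‖ ≤
        Real.exp (2 * a ^ 2) * Real.exp (-(a * h * (N / 2))) * Real.exp (-(a * h * k)) := by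
    rw [Real.norm_of_nonneg (eulerKernel_nonneg _ _ _), mul_assoc, ← Real.exp_add]
    refine (eulerKernel_le a hl _).trans ?_
    rw [abs_mul, abs_of_pos hh, ← mul_assoc, ← neg_add, ← mul_add]
    gcongr
  have htail := (summable_and_norm_tsum_int_sub_sum_range_le
    (f := fun n : ℤ => eulerKernel a l (h * ((n - m : ℤ) : ℝ))) (mul_pos ha hh) N
    (fun k => hdecay _ k <| le_abs.2 <| Or.inl <| by push_cast; linarith)
    (fun k => hdecay _ k <| le_abs.2 <| Or.inr <| by push_cast; linarith)).2
  have hshift : ∑' n : ℤ, eulerKernel a l (h * ((n - m : ℤ) : ℝ)) =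
      ∑' n : ℤ, eulerKernel a l (h * n) :=
    (Equiv.subRight (m : ℤ)).tsum_eq fun n : ℤ => eulerKernel a l (h * n)
  rw [hshift] at htail
  simpa only [Real.norm_eq_abs, Int.cast_sub, Int.cast_natCast] using htail

lemma abs_Gamma_mul_rpow_neg_sub_sum_eulerKernel_le {a l h : ℝ} (ha : 0 < a) (hl : 1 ≤ l)
    (hh : 0 < h) (N : ℕ) :
    |l ^ (-a) * Real.Gamma a -
        ∑ k ∈ Finset.range N, h * eulerKernel a l (h * (k - (N / 2 : ℕ)))| ≤
      2 * (√2 ^ a * Real.Gamma a * Real.exp (-(Real.pi ^ 2 / 2 / h))) *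
          (1 + h / (Real.pi ^ 2 / 2)) +
        2 * (Real.exp (2 * a ^ 2) * Real.exp (-(a * h * (N / 2)))) * (h + 1 / a) := by
  have htrap := abs_trapezoidal_eulerKernel_sub_le ha hl hh
  have htail := mul_le_mul_of_nonneg_left (abs_tsum_eulerKernel_sub_sum_range_le ha hl hh N) hh.le
  rw [← abs_of_pos hh, ← abs_mul, abs_of_pos hh, mul_sub] at htail
  rw [abs_sub_comm] at htrap
  rw [← Finset.mul_sum]
  refine (abs_sub_le _ _ _).trans ((add_le_add htrap htail).trans_eq ?_)
  congr 1
  field_simp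

lemma abs_Gamma_mul_rpow_neg_sub_sum_eulerKernel_le_exp {a l : ℝ} (ha : 0 < a) (hl : 1 ≤ l)
    {N : ℕ} (hN : 0 < N) :
    |l ^ (-a) * Real.Gamma a - ∑ k ∈ Finset.range N, Real.pi / √(a * N) *
        eulerKernel a l (Real.pi / √(a * N) * (k - (N / 2 : ℕ)))| ≤
      (2 * (√2 ^ a * Real.Gamma a) * (1 + Real.pi / √a / (Real.pi ^ 2 / 2)) +
        2 * Real.exp (2 * a ^ 2) * (Real.pi / √a + 1 / a)) *
        Real.exp (-(Real.pi / 2) * √(a * N)) := by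
  have : 0 < Real.Gamma a := Real.Gamma_pos_of_pos ha
  have haN : 0 < a * N := by positivity
  set H : ℝ := Real.pi / √a with hH
  -- this step size makes the discretization and the truncation error equally small
  set h : ℝ := Real.pi / √(a * N) with hh
  set ε : ℝ := Real.exp (-(Real.pi / 2) * √(a * N)) with hε
  have hhH : h ≤ H := by
    rw [hh, hH]
    gcongr
    exact le_mul_of_one_le_right ha.le (by exact_mod_cast hN)
  have hdisc : Real.exp (-(Real.pi ^ 2 / 2 / h)) = ε := by
    rw [hε, hh]
    congr 1
    field_simp
  have htrunc : Real.exp (-(a * h * (N / 2))) = ε := by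
    rw [hε, hh]
    congr 1
    field_simp
    rw [Real.sq_sqrt haN.le]
  have hle := abs_Gamma_mul_rpow_neg_sub_sum_eulerKernel_le ha hl (h := h) (by positivity) N
  rw [hdisc, htrunc] at hle
  calc _ ≤ 2 * (√2 ^ a * Real.Gamma a * ε) * (1 + h / (Real.pi ^ 2 / 2)) +
        2 * (Real.exp (2 * a ^ 2) * ε) * (h + 1 / a) := hle
    _ ≤ 2 * (√2 ^ a * Real.Gamma a * ε) * (1 + H / (Real.pi ^ 2 / 2)) +
          2 * (Real.exp (2 * a ^ 2) * ε) * (H + 1 / a) := by gcongr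
    _ = _ := by ring

lemma exists_expSum_approx_rpow_neg {a : ℝ} (ha : 0 < a) :
    ∃ K : ℝ, 0 < K ∧ ∀ N : ℕ, ∃ w t : ℕ → ℝ, (∀ k, 0 < t k) ∧ ∀ l : ℝ, 1 ≤ l →
      |l ^ (-a) - ∑ k ∈ Finset.range N, w k * Real.exp (-(t k * l))| ≤
        K * Real.exp (-(Real.pi / 2) * √(a * N)) := by
  have hΓ : 0 < Real.Gamma a := Real.Gamma_pos_of_pos ha
  set C : ℝ := 2 * (√2 ^ a * Real.Gamma a) * (1 + Real.pi / √a / (Real.pi ^ 2 / 2)) +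
    2 * Real.exp (2 * a ^ 2) * (Real.pi / √a + 1 / a)
  have hC : 0 < C / Real.Gamma a := by positivity
  refine ⟨C / Real.Gamma a + 1, by positivity, fun N => ?_⟩
  rcases N.eq_zero_or_pos with rfl | hN
  · refine ⟨0, 1, fun _ => one_pos, fun l hl => ?_⟩
    have hle : l ^ (-a) ≤ 1 := Real.rpow_le_one_of_one_le_of_nonpos hl (neg_nonpos.2 ha.le)
    have hnonneg : 0 ≤ l ^ (-a) := Real.rpow_nonneg (zero_le_one.trans hl) _
    simp only [Finset.range_zero, Finset.sum_empty, sub_zero, Nat.cast_zero, mul_zero,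
      Real.sqrt_zero, Real.exp_zero, mul_one, abs_of_nonneg hnonneg]
    linarith
  set h : ℝ := Real.pi / √(a * N)
  refine ⟨fun k => h * Real.exp (-(a * (h * (k - (N / 2 : ℕ))))) / Real.Gamma a,
    fun k => Real.exp (-(h * (k - (N / 2 : ℕ)))), fun k => Real.exp_pos _, fun l hl => ?_⟩
  calc _ = |l ^ (-a) * Real.Gamma a -
        ∑ k ∈ Finset.range N, h * eulerKernel a l (h * (k - (N / 2 : ℕ)))| / Real.Gamma a := by
        rw [← abs_of_pos hΓ, ← abs_div, abs_of_pos hΓ, sub_div, mul_div_cancel_right₀ _ hΓ.ne',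
          Finset.sum_div]
        congr! 3 with k
        rw [eulerKernel, mul_comm l]
        ring
    _ ≤ C * Real.exp (-(Real.pi / 2) * √(a * N)) / Real.Gamma a := by
        gcongr
        exact abs_Gamma_mul_rpow_neg_sub_sum_eulerKernel_le_exp ha hl hN
    _ = C / Real.Gamma a * Real.exp (-(Real.pi / 2) * √(a * N)) := by ring
    _ ≤ _ := by gcongr; linarith

end ExponentialSums

section InverseExponential

/-- The function `exp (-t / x)` of `x > 0`, continuously extended by `0` to `x ≤ 0` when `t > 0`.
Its value at the inverse of a positive operator `T` is the semigroup `exp (-t T)`. -/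
def expNegDiv (t x : ℝ) : ℝ := expNegInvGlue (x / t)

lemma continuous_expNegDiv (t : ℝ) : Continuous (expNegDiv t) :=
  (expNegInvGlue.contDiff (n := 0)).continuous.comp (continuous_id.div_const t)

lemma expNegDiv_zero_right (t : ℝ) : expNegDiv t 0 = 0 := by
  rw [expNegDiv, zero_div, expNegInvGlue.zero]

lemma expNegDiv_of_pos {t x : ℝ} (ht : 0 < t) (hx : 0 < x) :
    expNegDiv t x = Real.exp (-(t / x)) := by
  rw [expNegDiv, expNegInvGlue, if_neg (div_pos hx ht).not_ge, inv_div]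

lemma exp_mul_expNegDiv {t x : ℝ} (ht : 0 < t) (hx : 0 < x) :
    Real.exp t * expNegDiv t x = Real.exp (-(t * (x⁻¹ - 1))) := by
  rw [expNegDiv_of_pos ht hx, ← Real.exp_add]
  ring_nf

lemma abs_rpow_sub_sum_expNegDiv_le {α β ε : ℝ} (hα : 0 < α) (hβ : 0 < β) {N : ℕ} {w t : ℕ → ℝ}
    (ht : ∀ k, 0 < t k)
    (h : ∀ l : ℝ, 1 ≤ l → |l ^ (-α) - ∑ k ∈ Finset.range N, w k * Real.exp (-(t k * l))| ≤ ε)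
    {x : ℝ} (hx : x ∈ Set.Icc 0 β) :
    |x ^ α - ∑ k ∈ Finset.range N, β ^ α * w k * expNegDiv (t k * β) x| ≤ β ^ α * ε := by
  rcases hx.1.eq_or_lt with rfl | hx₀
  · have hε : 0 ≤ ε := (abs_nonneg _).trans (h 1 le_rfl)
    simp only [Real.zero_rpow hα.ne', expNegDiv_zero_right, mul_zero, Finset.sum_const_zero,
      sub_zero, abs_zero]
    positivity
  · have hscale : x ^ α = β ^ α * (β / x) ^ (-α) := by
      rw [Real.rpow_neg (by positivity), Real.div_rpow hβ.le hx₀.le]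
      field_simp
    have hsum : ∑ k ∈ Finset.range N, β ^ α * w k * expNegDiv (t k * β) x =
        β ^ α * ∑ k ∈ Finset.range N, w k * Real.exp (-(t k * (β / x))) := by
      rw [Finset.mul_sum]
      refine Finset.sum_congr rfl fun k _ => ?_
      rw [expNegDiv_of_pos (mul_pos (ht k) hβ) hx₀, mul_assoc, mul_div_assoc]
    rw [hscale, hsum, ← mul_sub, abs_mul, abs_of_pos (Real.rpow_pos_of_pos hβ α)]
    gcongr
    exact h _ ((one_le_div hx₀).2 hx.2)

lemma exists_sum_expNegDiv_approx_rpow {α : ℝ} (hα : 0 < α) :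
    ∃ K : ℝ, 0 < K ∧ ∀ β : ℝ, 0 ≤ β → ∀ N : ℕ, ∃ w t : ℕ → ℝ, (∀ k, 0 < t k) ∧
      ∀ x ∈ Set.Icc 0 β, |x ^ α - ∑ k ∈ Finset.range N, w k * expNegDiv (t k) x| ≤
        K * β ^ α * Real.exp (-(Real.pi / 2) * √(α * N)) := by
  obtain ⟨K, hK, happrox⟩ := exists_expSum_approx_rpow_neg hα
  refine ⟨K, hK, fun β hβ N => ?_⟩
  rcases hβ.eq_or_lt with rfl | hβ
  · refine ⟨0, 1, fun _ => one_pos, fun x hx => ?_⟩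
    obtain rfl : x = 0 := le_antisymm hx.2 hx.1
    simp [Real.zero_rpow hα.ne']
  · obtain ⟨w, t, ht, h⟩ := happrox N
    refine ⟨fun k => β ^ α * w k, fun k => t k * β, fun k => mul_pos (ht k) hβ, fun x hx => ?_⟩
    exact (abs_rpow_sub_sum_expNegDiv_le hα hβ ht h hx).trans_eq (by ring)

end InverseExponential

section CommutingElements

/-- The element `exp (-t b⁻¹)` for positive `b`, where `b` may have `0` in its spectrum: there
`expNegDiv t` is extended by `0`. -/
def expNegInv {A : Type*} [CStarAlgebra A] (t : ℝ) (b : A) : A := cfc (expNegDiv t) b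

open scoped CStarAlgebra in
lemma map_expNegInv {A B : Type*} [CStarAlgebra A] [CStarAlgebra B] (φ : A →⋆ₐ[ℂ] B) (t : ℝ)
    {b : A} (hb : IsSelfAdjoint b) : φ (expNegInv t b) = expNegInv t (φ b) :=
  StarAlgHomClass.map_cfc (S := ℂ) φ _ b (continuous_expNegDiv t).continuousOn (map_continuous φ)
    hb (hb.map φ)

lemma norm_rpow_sub_sum_smul_expNegInv_le {A : Type*} [CStarAlgebra A] [PartialOrder A]
    [StarOrderedRing A] {b : A} (hb : 0 ≤ b) {α : ℝ} (hα : 0 < α) {N : ℕ} {w t : ℕ → ℝ} {ε : ℝ}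
    (hε : 0 ≤ ε)
    (h : ∀ x ∈ Set.Icc 0 ‖b‖, |x ^ α - ∑ k ∈ Finset.range N, w k * expNegDiv (t k) x| ≤ ε) :
    ‖b ^ α - ∑ k ∈ Finset.range N, w k • expNegInv (t k) b‖ ≤ ε := by
  rcases subsingleton_or_nontrivial A with _ | _
  · rwa [Subsingleton.elim (b ^ α - _) 0, norm_zero]
  have hcont (k : ℕ) : Continuous (expNegDiv (t k)) := continuous_expNegDiv (t k)
  have hsum : ∑ k ∈ Finset.range N, w k • expNegInv (t k) b =
      cfc (fun x => ∑ k ∈ Finset.range N, w k * expNegDiv (t k) x) b := by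
    rw [← Finset.sum_fn, cfc_sum (fun k x => w k * expNegDiv (t k) x) b _ fun k _ => by fun_prop]
    exact Finset.sum_congr rfl fun k _ => (cfc_const_mul _ _ b (by fun_prop)).symm
  have hrpow : Continuous fun x : ℝ => x ^ α := Real.continuous_rpow_const hα.le
  rw [CFC.rpow_eq_cfc_real hb, hsum, ← cfc_sub _ _ b hrpow.continuousOn (by fun_prop)]
  exact norm_cfc_le hε fun x hx => h x
    ⟨spectrum_nonneg_of_nonneg hb hx, (Real.le_norm_self x).trans (spectrum.norm_le_norm_of_mem hx)⟩

lemma mul_sum_inv_sub_one_eq_one {F : Type*} [Field F] {d : ℕ} {r : Fin d → F} {b : F}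
    (hr : ∀ i, r i ≠ 0) (h : b * ∑ j, ∏ i, Function.update r j (1 - r j) i = ∏ i, r i) :
    b * ∑ j, ((r j)⁻¹ - 1) = 1 := by
  have hprod : ∏ i, r i ≠ 0 := Finset.prod_ne_zero_iff.2 fun i _ => hr i
  have hsum : ∑ j, ∏ i, Function.update r j (1 - r j) i = (∏ i, r i) * ∑ j, ((r j)⁻¹ - 1) := by
    rw [Finset.mul_sum]
    refine Finset.sum_congr rfl fun j hj => ?_
    rw [Finset.prod_update_of_mem hj, ← Finset.mul_prod_erase _ r hj,
      Finset.sdiff_singleton_eq_erase]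
    field_simp [hr j]
  refine mul_left_cancel₀ hprod ?_
  linear_combination h - b * hsum

lemma pos_of_mul_sum_inv_sub_one_eq_one {d : ℕ} {r : Fin d → ℝ} {b : ℝ}
    (hr : ∀ i, r i ∈ Set.Ioc 0 1) (h : b * ∑ j, ((r j)⁻¹ - 1) = 1) : 0 < b := by
  have hsum : 0 ≤ ∑ j, ((r j)⁻¹ - 1) :=
    Finset.sum_nonneg fun j _ => sub_nonneg.2 ((one_le_inv₀ (hr j).1).2 (hr j).2)
  exact pos_of_mul_pos_left (h.symm ▸ one_pos : 0 < b * ∑ j, ((r j)⁻¹ - 1)) hsum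

lemma prod_exp_mul_expNegDiv {d : ℕ} {r : Fin d → ℝ} {b t : ℝ} (hr : ∀ i, 0 < r i) (hb : 0 < b)
    (ht : 0 < t) (h : b * ∑ j, ((r j)⁻¹ - 1) = 1) :
    ∏ i, Real.exp t * expNegDiv t (r i) = expNegDiv t b := by
  simp_rw [exp_mul_expNegDiv ht (hr _)]
  rw [expNegDiv_of_pos ht hb, ← Real.exp_sum, Finset.sum_neg_distrib, ← Finset.mul_sum,
    eq_inv_of_mul_eq_one_right h, div_eq_mul_inv]

open WeakDual in
lemma eq_of_forall_character {A : Type*} [CommCStarAlgebra A] {p x y : A} (hp : IsLeftRegular p)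
    (h : ∀ χ : characterSpace ℂ A, χ p ≠ 0 → χ x = χ y) : x = y := by
  refine hp ((gelfandTransform_bijective A).1 (ContinuousMap.ext fun χ => ?_))
  change χ (p * x) = χ (p * y)
  rw [map_mul, map_mul]
  by_cases hχ : χ p = 0
  · rw [hχ, zero_mul, zero_mul]
  · rw [h χ hχ]

section Commutative

open WeakDual

variable {A : Type*} [CommCStarAlgebra A] (χ : characterSpace ℂ A)

lemma apply_eq_re_of_character {a : A} (ha : IsSelfAdjoint a) : χ a = ((χ a).re : ℂ) :=
  (Complex.conj_eq_iff_re.1 (ha.map χ)).symm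

lemma apply_cfc_of_character {f : ℝ → ℝ} (hf : Continuous f) {a : A} (ha : IsSelfAdjoint a) :
    χ (cfc f a) = (f (χ a).re : ℂ) := by
  rw [StarAlgHomClass.map_cfc (S := ℂ) χ f a hf.continuousOn (map_continuous χ) ha (ha.map χ),
    apply_eq_re_of_character χ ha]
  exact cfc_algebraMap _ _

lemma re_apply_mul_sum_inv_sub_one_eq_one {d : ℕ} {r : Fin d → A} {b : A}
    (hr : ∀ i, IsSelfAdjoint (r i)) (hb : IsSelfAdjoint b)
    (h : b * ∑ j, ∏ i, Function.update r j (1 - r j) i = ∏ i, r i) (hχ : ∀ i, χ (r i) ≠ 0) :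
    (χ b).re * ∑ j, ((χ (r j)).re⁻¹ - 1) = 1 := by
  have hχb : χ b * ∑ j, ((χ (r j))⁻¹ - 1) = 1 := by
    refine mul_sum_inv_sub_one_eq_one (r := fun i => χ (r i)) hχ ?_
    have hupdate (j i : Fin d) : χ (Function.update r j (1 - r j) i) =
        Function.update (fun i => χ (r i)) j (1 - χ (r j)) i := by
      rw [Function.apply_update fun _ => χ, map_sub, map_one]
    simpa only [map_mul, map_sum, map_prod, hupdate] using congrArg χ h
  have hre (i : Fin d) : χ (r i) = ((χ (r i)).re : ℂ) := apply_eq_re_of_character χ (hr i)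
  rw [apply_eq_re_of_character χ hb, Finset.sum_congr rfl fun j _ => by rw [hre j]] at hχb
  exact_mod_cast hχb

lemma cfc_max_zero_and_prod_expNegInv_of_comm {d : ℕ} {r : Fin d → A} {b : A}
    (hr : ∀ i, IsSelfAdjoint (r i)) (hspec : ∀ i, spectrum ℝ (r i) ⊆ Set.Icc 0 1)
    (hreg : IsLeftRegular (∏ i, r i)) (hb : IsSelfAdjoint b)
    (h : b * ∑ j, ∏ i, Function.update r j (1 - r j) i = ∏ i, r i) :
    cfc (fun x : ℝ => max x 0) b = b ∧ ∀ t : ℝ, 0 < t →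
      ∏ i, Real.exp t • expNegInv t (r i) = expNegInv t b := by
  have hmem (χ : characterSpace ℂ A) (hχ : χ (∏ i, r i) ≠ 0) (i : Fin d) :
      (χ (r i)).re ∈ Set.Ioc 0 1 := by
    have hne : (χ (r i)).re ≠ 0 := fun h0 => hχ <| by
      rw [map_prod, Finset.prod_eq_zero (Finset.mem_univ i)]
      rw [apply_eq_re_of_character χ (hr i), h0, Complex.ofReal_zero]
    have hmem : (χ (r i)).re ∈ Set.Icc 0 1 := hspec i <| (spectrum.algebraMap_mem_iff ℂ).1 <| by
      simpa only [Complex.coe_algebraMap, ← apply_eq_re_of_character χ (hr i)] using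
        AlgHom.apply_mem_spectrum χ (r i)
    exact ⟨hmem.1.lt_of_ne' hne, hmem.2⟩
  have hrel (χ : characterSpace ℂ A) (hχ : χ (∏ i, r i) ≠ 0) :
      (χ b).re * ∑ j, ((χ (r j)).re⁻¹ - 1) = 1 :=
    re_apply_mul_sum_inv_sub_one_eq_one χ hr hb h fun i hi =>
      (hmem χ hχ i).1.ne' (by rw [hi, Complex.zero_re])
  have hpos (χ : characterSpace ℂ A) (hχ : χ (∏ i, r i) ≠ 0) : 0 < (χ b).re :=
    pos_of_mul_sum_inv_sub_one_eq_one (hmem χ hχ) (hrel χ hχ)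
  refine ⟨eq_of_forall_character hreg fun χ hχ => ?_, fun t ht =>
    eq_of_forall_character hreg fun χ hχ => ?_⟩
  · rw [apply_cfc_of_character χ (by fun_prop) hb, max_eq_left (hpos χ hχ).le,
      ← apply_eq_re_of_character χ hb]
  · have hcont := continuous_expNegDiv t
    simp_rw [map_prod, ← Complex.coe_smul, map_smul, expNegInv,
      apply_cfc_of_character χ hcont (hr _), smul_eq_mul, ← Complex.ofReal_mul]
    rw [apply_cfc_of_character χ hcont hb, ← Complex.ofReal_prod,
      prod_exp_mul_expNegDiv (fun i => (hmem χ hχ i).1) (hpos χ hχ) ht (hrel χ hχ)]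

end Commutative

end CommutingElements

section CommutingFamily

lemma isSelfAdjoint_list_prod {R : Type*} [Monoid R] [StarMul R] {l : List R}
    (hsa : ∀ x ∈ l, IsSelfAdjoint x) (hcomm : ∀ x ∈ l, ∀ y ∈ l, Commute x y) :
    IsSelfAdjoint l.prod := by
  induction l with
  | nil => exact .one R
  | cons x l ih =>
    simp only [List.forall_mem_cons] at hsa hcomm
    rw [List.prod_cons]
    exact (hsa.1.commute_iff (ih hsa.2 fun y hy => (hcomm.2 y hy).2)).1
      (Commute.list_prod_right _ _ hcomm.1.2)

lemma isSelfAdjoint_of_mul_eq {R : Type*} [Semigroup R] [StarMul R] {b p q : R}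
    (hreg : IsLeftRegular p) (hp : IsSelfAdjoint p) (hq : IsSelfAdjoint q) (hcomm : Commute b q)
    (h : b * q = p) : IsSelfAdjoint b := by
  have hstar : q * star b = p := by rw [← hp.star_eq, ← h, star_mul, hq.star_eq]
  refine hreg ?_
  calc p * star b = b * (q * star b) := by rw [← h, mul_assoc]
    _ = b * (b * q) := by rw [hstar, h]
    _ = p * b := by rw [hcomm.eq, ← mul_assoc, h]

lemma isSelfAdjoint_of_mul_sum_prod_update_eq {R : Type*} [Ring R] [StarRing R] {d : ℕ}
    {r : Fin d → R} {b : R} (hsa : ∀ i, IsSelfAdjoint (r i)) (hrr : ∀ i j, Commute (r i) (r j))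
    (hreg : IsLeftRegular (List.ofFn r).prod) (hbr : ∀ i, Commute b (r i))
    (h : b * ∑ j, (List.ofFn (Function.update r j (1 - r j))).prod = (List.ofFn r).prod) :
    IsSelfAdjoint b := by
  have hupdate (j i : Fin d) :
      Function.update r j (1 - r j) i = r i ∨ Function.update r j (1 - r j) i = 1 - r i := by
    rcases eq_or_ne i j with rfl | hij
    · exact .inr (Function.update_self ..)
    · exact .inl (Function.update_of_ne hij ..)
  have hupdate_sa (j i : Fin d) : IsSelfAdjoint (Function.update r j (1 - r j) i) := by
    rcases hupdate j i with h | h <;> rw [h]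
    exacts [hsa i, (IsSelfAdjoint.one R).sub (hsa i)]
  have hupdate_comm (j i : Fin d) {x : R} (hx : ∀ k, Commute x (r k)) :
      Commute x (Function.update r j (1 - r j) i) := by
    rcases hupdate j i with h | h <;> rw [h]
    exacts [hx i, (Commute.one_right x).sub_right (hx i)]
  have hp : IsSelfAdjoint (List.ofFn r).prod :=
    isSelfAdjoint_list_prod (by simpa using hsa) (by simpa using hrr)
  have hq : IsSelfAdjoint (∑ j, (List.ofFn (Function.update r j (1 - r j))).prod) :=
    isSelfAdjoint_sum _ fun j _ => isSelfAdjoint_list_prod (by simpa using hupdate_sa j) <| by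
      simpa using fun i k => hupdate_comm j k fun l => (hupdate_comm j i (hrr l)).symm
  have hbq : Commute b (∑ j, (List.ofFn (Function.update r j (1 - r j))).prod) :=
    Commute.sum_right _ _ _ fun j _ => Commute.list_prod_right _ _ <| by
      simpa using fun i => hupdate_comm j i hbr
  exact isSelfAdjoint_of_mul_eq hreg hp hq hbq h

lemma map_prod_eq_prod_ofFn {M N F : Type*} [CommMonoid M] [Monoid N] [FunLike F M N]
    [MonoidHomClass F M N] (φ : F) {d : ℕ} (g : Fin d → M) :
    φ (∏ i, g i) = (List.ofFn fun i => φ (g i)).prod := by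
  rw [← List.prod_ofFn, map_list_prod, List.map_ofFn]
  rfl

variable {A : Type*} [CStarAlgebra A]

lemma exists_isClosed_commutative_starSubalgebra {s : Set A} (hsa : ∀ x ∈ s, IsSelfAdjoint x)
    (hcomm : ∀ x ∈ s, ∀ y ∈ s, Commute x y) :
    ∃ S : StarSubalgebra ℂ A, IsClosed (S : Set A) ∧ IsMulCommutative S ∧ s ⊆ S := by
  have := StarAlgebra.isMulCommutative_adjoin ℂ hcomm fun x hx y hy =>
    (hsa y hy).star_eq.symm ▸ hcomm x hx y hy
  exact ⟨(StarAlgebra.adjoin ℂ s).topologicalClosure, StarSubalgebra.isClosed_topologicalClosure _,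
    ⟨⟨(StarSubalgebra.commRingTopologicalClosure (StarAlgebra.adjoin ℂ s) mul_comm').mul_comm⟩⟩,
    (StarAlgebra.subset_adjoin ℂ s).trans subset_closure⟩

lemma spectrum_real_coe_eq (S : StarSubalgebra ℂ A) [IsClosed (S : Set A)] (x : S) :
    spectrum ℝ x = spectrum ℝ (x : A) := by
  rw [← spectrum.preimage_algebraMap ℂ, S.spectrum_eq, spectrum.preimage_algebraMap]

lemma cfc_max_zero_and_prod_expNegInv_of_mem {S : StarSubalgebra ℂ A} (hS : IsClosed (S : Set A))
    [IsMulCommutative S] {d : ℕ} {r : Fin d → S} {b : S} (hr : ∀ i, IsSelfAdjoint (r i))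
    (hspec : ∀ i, spectrum ℝ (r i : A) ⊆ Set.Icc 0 1)
    (hreg : IsLeftRegular (List.ofFn fun i => (r i : A)).prod) (hb : IsSelfAdjoint b)
    (h : b * ∑ j, (List.ofFn (Function.update r j (1 - r j))).prod = (List.ofFn r).prod) :
    cfc (fun x : ℝ => max x 0) (b : A) = b ∧ ∀ t : ℝ, 0 < t →
      (List.ofFn fun i => Real.exp t • expNegInv t (r i : A)).prod = expNegInv t (b : A) := by
  let _ : CommCStarAlgebra S := { StarSubalgebra.cstarAlgebra S with mul_comm := mul_comm' }
  have hprod (g : Fin d → S) : ((∏ i, g i : S) : A) = (List.ofFn fun i => (g i : A)).prod :=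
    map_prod_eq_prod_ofFn S.subtype g
  have hspecS (i : Fin d) : spectrum ℝ (r i) ⊆ Set.Icc 0 1 :=
    (spectrum_real_coe_eq S (r i)).trans_subset (hspec i)
  have hregS : IsLeftRegular (∏ i, r i) := fun x y hxy => Subtype.ext <| hreg <| by
    simp only [← hprod]
    exact congrArg Subtype.val hxy
  simp only [List.prod_ofFn] at h
  obtain ⟨hmax, hexp⟩ := cfc_max_zero_and_prod_expNegInv_of_comm hr hspecS hregS hb h
  refine ⟨?_, fun t ht => ?_⟩
  · exact (StarAlgHomClass.map_cfc (S := ℂ) S.subtype _ b (by fun_prop) continuous_subtype_val hb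
      (hb.map S.subtype)).symm.trans (congrArg Subtype.val hmax)
  · have hmap {x : S} (hx : IsSelfAdjoint x) : ((expNegInv t x : S) : A) = expNegInv t (x : A) :=
      map_expNegInv S.subtype t hx
    simp_rw [← hmap (hr _)]
    rw [← hmap hb, ← hexp t ht, hprod]
    rfl

lemma cfc_max_zero_and_prod_expNegInv {d : ℕ} {r : Fin d → A} {b : A}
    (hr : ∀ i, IsSelfAdjoint (r i)) (hspec : ∀ i, spectrum ℝ (r i) ⊆ Set.Icc 0 1)
    (hrr : ∀ i j, Commute (r i) (r j)) (hreg : IsLeftRegular (List.ofFn r).prod)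
    (hb : IsSelfAdjoint b) (hbr : ∀ i, Commute b (r i))
    (h : b * ∑ j, (List.ofFn (Function.update r j (1 - r j))).prod = (List.ofFn r).prod) :
    cfc (fun x : ℝ => max x 0) b = b ∧ ∀ t : ℝ, 0 < t →
      (List.ofFn fun i => Real.exp t • expNegInv t (r i)).prod = expNegInv t b := by
  obtain ⟨S, hS, _, hsub⟩ := exists_isClosed_commutative_starSubalgebra
    (s := insert b (Set.range r))
    (by rintro x (rfl | ⟨i, rfl⟩); exacts [hb, hr i])
    (by rintro x (rfl | ⟨i, rfl⟩) y (rfl | ⟨j, rfl⟩); exacts [rfl, hbr j, (hbr i).symm, hrr i j])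
  obtain ⟨b, rfl⟩ : ∃ b' : S, b = b' := ⟨⟨b, hsub (Set.mem_insert _ _)⟩, rfl⟩
  obtain ⟨r, rfl⟩ : ∃ r' : Fin d → S, r = fun i => (r' i : A) :=
    ⟨fun i => ⟨r i, hsub (Set.mem_insert_of_mem _ ⟨i, rfl⟩)⟩, rfl⟩
  have hcoe (g : Fin d → S) :
      (((List.ofFn g).prod : S) : A) = (List.ofFn fun i => (g i : A)).prod :=
    (map_list_prod S.subtype _).trans (congrArg List.prod List.map_ofFn)
  have hupdate (j : Fin d) : (fun i => (Function.update r j (1 - r j) i : A)) =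
      Function.update (fun i => (r i : A)) j (1 - r j) :=
    funext fun i => Function.apply_update (fun _ => Subtype.val) r j (1 - r j) i
  refine cfc_max_zero_and_prod_expNegInv_of_mem hS (fun i => Subtype.ext (hr i)) hspec hreg
    (Subtype.ext hb) (Subtype.ext ?_)
  rw [hcoe, ← h, MulMemClass.coe_mul, AddSubmonoidClass.coe_finsetSum]
  simp only [hcoe, hupdate]

lemma nonneg_and_prod_expNegInv [PartialOrder A] [StarOrderedRing A] {d : ℕ}
    {r : Fin d → A} {b : A} (hr₀ : ∀ i, 0 ≤ r i) (hr₁ : ∀ i, r i ≤ 1)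
    (hrr : ∀ i j, Commute (r i) (r j)) (hreg : IsLeftRegular (List.ofFn r).prod)
    (hbr : ∀ i, Commute b (r i))
    (h : b * ∑ j, (List.ofFn (Function.update r j (1 - r j))).prod = (List.ofFn r).prod) :
    0 ≤ b ∧ ∀ t : ℝ, 0 < t →
      (List.ofFn fun i => Real.exp t • expNegInv t (r i)).prod = expNegInv t b := by
  have hsa (i : Fin d) : IsSelfAdjoint (r i) := .of_nonneg (hr₀ i)
  have hspec (i : Fin d) : spectrum ℝ (r i) ⊆ Set.Icc 0 1 := fun x hx =>
    ⟨spectrum_nonneg_of_nonneg (hr₀ i) hx, (CFC.le_one_iff (r i)).1 (hr₁ i) x hx⟩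
  have hb : IsSelfAdjoint b :=
    isSelfAdjoint_of_mul_sum_prod_update_eq hsa hrr hreg hbr h
  obtain ⟨hmax, hexp⟩ := cfc_max_zero_and_prod_expNegInv hsa hspec hrr hreg hb hbr h
  exact ⟨hmax ▸ cfc_nonneg fun x _ => le_max_right x 0, hexp⟩

end CommutingFamily

section Resolvent

variable {H : Type u} [NormedAddCommGroup H] [InnerProductSpace ℂ H]
  {A : H →ₗ.[ℂ] H} {R : H →L[ℂ] H}

/-- `R` is the resolvent `(1 + A)⁻¹`. -/
structure IsResolvent (A : H →ₗ.[ℂ] H) (R : H →L[ℂ] H) : Prop where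
  mem_domain : ∀ y, R y ∈ A.domain
  apply_eq : ∀ y, A ⟨R y, mem_domain y⟩ = y - R y
  map_add_apply : ∀ v : A.domain, R (v + A v) = v

lemma IsResolvent.injective (hR : IsResolvent A R) : Function.Injective R := by
  refine (injective_iff_map_eq_zero R).2 fun y hy => ?_
  have h := hR.apply_eq y
  simp only [hy, sub_zero] at h
  exact h.symm.trans A.map_zero

variable [CompleteSpace H]

/-- `A` is positive semidefinite: self-adjoint (in particular densely defined), with
`⟪A v, v⟫ ≥ 0` for all `v` in its domain. -/
def IsPSD (A : H →ₗ.[ℂ] H) : Prop :=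
  IsSelfAdjoint A ∧ ∀ v : A.domain, 0 ≤ (⟪A v, (v : H)⟫_ℂ).re

lemma IsSPD.isPSD (hA : IsSPD A) : IsPSD A := by
  refine ⟨hA.1, fun v => ?_⟩
  rcases eq_or_ne (v : H) 0 with hv | hv
  · rw [hv, inner_zero_right, Complex.zero_re]
  · exact (hA.2 v hv).le

lemma IsPSD.inner_apply_left (hA : IsPSD A) (v w : A.domain) :
    ⟪A v, (w : H)⟫_ℂ = ⟪(v : H), A w⟫_ℂ := by
  have h := LinearPMap.adjoint_isFormalAdjoint hA.1.dense_domain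
  rw [LinearPMap.isSelfAdjoint_def.1 hA.1] at h
  exact h v w

lemma IsPSD.norm_sq_add_norm_sq_le (hA : IsPSD A) (v : A.domain) :
    ‖(v : H)‖ ^ 2 + ‖A v‖ ^ 2 ≤ ‖(v : H) + A v‖ ^ 2 := by
  have hnonneg : 0 ≤ RCLike.re ⟪A v, (v : H)⟫_ℂ := hA.2 v
  rw [add_comm (v : H), norm_add_sq (𝕜 := ℂ)]
  linarith

lemma IsPSD.eq_zero_of_inner_add_apply_eq_zero (hA : IsPSD A) {y : H}
    (hy : ∀ v : A.domain, ⟪(v : H) + A v, y⟫_ℂ = 0) : y = 0 := by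
  have hadj (v : A.domain) : ⟪-y, (v : H)⟫_ℂ = ⟪y, A v⟫_ℂ := by
    have h := hy v
    rw [← inner_conj_symm, map_eq_zero, inner_add_right] at h
    rw [inner_neg_left]
    linear_combination -h
  have hmem : y ∈ A.adjoint.domain := LinearPMap.mem_adjoint_domain_of_exists y ⟨-y, hadj⟩
  have hgraph : (y, -y) ∈ A.adjoint.graph := by
    rw [← LinearPMap.adjoint_apply_eq hA.1.dense_domain ⟨y, hmem⟩ hadj]
    exact LinearPMap.mem_graph _ ⟨y, hmem⟩
  rw [LinearPMap.isSelfAdjoint_def.1 hA.1] at hgraph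
  obtain ⟨v, rfl, hv⟩ := A.mem_graph_iff.1 hgraph
  have hnonneg : 0 ≤ RCLike.re ⟪A v, (v : H)⟫_ℂ := hA.2 v
  rw [hv, inner_neg_left, map_neg, inner_self_eq_norm_sq, neg_nonneg] at hnonneg
  exact norm_eq_zero.1 (pow_eq_zero_iff two_ne_zero |>.1 (hnonneg.antisymm (sq_nonneg _)))

/-- The operator `1 + A`, regarded as a bounded operator on the graph of `A`. -/
def oneAddOnGraph (A : H →ₗ.[ℂ] H) : A.graph →L[ℂ] H :=
  (ContinuousLinearMap.fst ℂ H H + ContinuousLinearMap.snd ℂ H H).comp A.graph.subtypeL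

lemma IsPSD.antilipschitzWith_oneAddOnGraph (hA : IsPSD A) :
    AntilipschitzWith 1 (oneAddOnGraph A) := by
  refine AddMonoidHomClass.antilipschitz_of_bound _ fun ⟨⟨v, w⟩, hx⟩ => ?_
  obtain ⟨v, rfl, rfl⟩ := A.mem_graph_iff.1 hx
  have h := hA.norm_sq_add_norm_sq_le v
  rw [NNReal.coe_one, one_mul]
  change max ‖(v : H)‖ ‖A v‖ ≤ ‖(v : H) + A v‖
  exact max_le (le_of_sq_le_sq (by linarith [sq_nonneg ‖A v‖]) (norm_nonneg _))
    (le_of_sq_le_sq (by linarith [sq_nonneg ‖(v : H)‖]) (norm_nonneg _))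

lemma IsPSD.surjective_oneAddOnGraph (hA : IsPSD A) : Function.Surjective (oneAddOnGraph A) := by
  have : CompleteSpace A.graph := hA.1.isClosed.completeSpace_coe
  have hclosed : IsClosed ((oneAddOnGraph A).range : Set H) := by
    rw [LinearMap.coe_range]
    exact hA.antilipschitzWith_oneAddOnGraph.isClosed_range (oneAddOnGraph A).uniformContinuous
  have : CompleteSpace (oneAddOnGraph A).range := hclosed.completeSpace_coe
  rw [← ContinuousLinearMap.coe_coe, ← LinearMap.range_eq_top, ← Submodule.orthogonal_eq_bot_iff,
    Submodule.eq_bot_iff]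
  intro y hy
  exact hA.eq_zero_of_inner_add_apply_eq_zero fun v =>
    (Submodule.mem_orthogonal _ _).1 hy _ ⟨⟨(v, A v), A.mem_graph v⟩, rfl⟩

lemma IsPSD.exists_isResolvent (hA : IsPSD A) : ∃ R, IsResolvent A R := by
  have : CompleteSpace A.graph := hA.1.isClosed.completeSpace_coe
  let e : A.graph ≃L[ℂ] H := ContinuousLinearEquiv.ofBijective (oneAddOnGraph A)
    (LinearMap.ker_eq_bot.2 hA.antilipschitzWith_oneAddOnGraph.injective)
    (LinearMap.range_eq_top.2 hA.surjective_oneAddOnGraph)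
  let R : H →L[ℂ] H :=
    (ContinuousLinearMap.fst ℂ H H).comp (A.graph.subtypeL.comp (e.symm : H →L[ℂ] A.graph))
  have hR (v : A.domain) : R (v + A v) = v :=
    congrArg (fun x : A.graph => (x : H × H).1) (e.symm_apply_apply ⟨(v, A v), A.mem_graph v⟩)
  have hsurj (y : H) : ∃ v : A.domain, (v : H) + A v = y := by
    obtain ⟨⟨⟨_, _⟩, hx⟩, rfl⟩ := hA.surjective_oneAddOnGraph y
    obtain ⟨v, rfl, rfl⟩ := A.mem_graph_iff.1 hx
    exact ⟨v, rfl⟩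
  have hval (y : H) : ∃ h : R y ∈ A.domain, A ⟨R y, h⟩ = y - R y := by
    obtain ⟨v, rfl⟩ := hsurj y
    simp only [hR, Subtype.coe_eta, add_sub_cancel_left, v.2, exists_true_left]
  exact ⟨R, fun y => (hval y).1, fun y => (hval y).2, hR⟩

lemma IsResolvent.isSelfAdjoint (hR : IsResolvent A R) (hA : IsPSD A) : IsSelfAdjoint R := by
  rw [ContinuousLinearMap.isSelfAdjoint_iff_isSymmetric]
  intro y z
  have h := hA.inner_apply_left ⟨R y, hR.mem_domain y⟩ ⟨R z, hR.mem_domain z⟩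
  simp only [hR.apply_eq, inner_sub_left, inner_sub_right] at h
  change ⟪R y, z⟫_ℂ = ⟪y, R z⟫_ℂ
  linear_combination -h

lemma IsResolvent.re_inner_sub_nonneg (hR : IsResolvent A R) (hA : IsPSD A) (y : H) :
    0 ≤ RCLike.re ⟪y - R y, R y⟫_ℂ := by
  simpa only [hR.apply_eq, RCLike.re_to_complex] using hA.2 ⟨R y, hR.mem_domain y⟩

lemma IsResolvent.nonneg (hR : IsResolvent A R) (hA : IsPSD A) : 0 ≤ R := by
  rw [ContinuousLinearMap.nonneg_iff_isPositive, ContinuousLinearMap.isPositive_def']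
  refine ⟨hR.isSelfAdjoint hA, fun y => ?_⟩
  have h := hR.re_inner_sub_nonneg hA y
  rw [inner_sub_left, map_sub, inner_self_eq_norm_sq, inner_re_symm] at h
  rw [ContinuousLinearMap.reApplyInnerSelf_apply]
  exact (sq_nonneg _).trans (sub_nonneg.1 h)

lemma IsResolvent.le_one (hR : IsResolvent A R) (hA : IsPSD A) : R ≤ 1 := by
  rw [← sub_nonneg, ContinuousLinearMap.nonneg_iff_isPositive, ContinuousLinearMap.isPositive_def']
  refine ⟨(IsSelfAdjoint.one _).sub (hR.isSelfAdjoint hA), fun y => ?_⟩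
  have hsplit : ⟪y - R y, y⟫_ℂ = ⟪y - R y, y - R y⟫_ℂ + ⟪y - R y, R y⟫_ℂ := by
    rw [← inner_add_right, sub_add_cancel]
  change 0 ≤ RCLike.re ⟪y - R y, y⟫_ℂ
  rw [hsplit, map_add]
  exact add_nonneg inner_self_nonneg (hR.re_inner_sub_nonneg hA y)

end Resolvent

section Ampliation

variable {κ a b : Type u}

lemma memℓp_two_of_summable {f : κ → ℂ} (hf : Summable fun k => ‖f k‖ ^ 2) : Memℓp f 2 :=
  memℓp_gen (by simpa using hf)

lemma hasSum_norm_sq (X : Ell2 κ) : HasSum (fun k => ‖X k‖ ^ 2) (‖X‖ ^ 2) := by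
  simpa using lp.hasSum_norm (p := 2) (by norm_num) X

/-- The column with index `q` of a family indexed by `κ ≃ a × b`. -/
def column (e : κ ≃ a × b) (X : Ell2 κ) (q : b) : Ell2 a :=
  ⟨fun x => X (e.symm (x, q)), memℓp_two_of_summable <|
    (hasSum_norm_sq X).summable.comp_injective (i := fun x => e.symm (x, q)) fun x y h => by
      simpa using h⟩

lemma column_apply (e : κ ≃ a × b) (X : Ell2 κ) (q : b) (x : a) :
    column e X q x = X (e.symm (x, q)) := rfl

lemma column_add (e : κ ≃ a × b) (X Y : Ell2 κ) (q : b) :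
    column e (X + Y) q = column e X q + column e Y q := rfl

lemma column_smul (e : κ ≃ a × b) (c : ℂ) (X : Ell2 κ) (q : b) :
    column e (c • X) q = c • column e X q := rfl

lemma ext_column {e : κ ≃ a × b} {X Y : Ell2 κ} (h : ∀ q, column e X q = column e Y q) :
    X = Y := by
  ext k
  simpa [column_apply] using congrArg (fun Z : Ell2 a => Z (e k).1) (h (e k).2)

lemma hasSum_inner_column (e : κ ≃ a × b) (X Y : Ell2 κ) :
    HasSum (fun q => ⟪column e X q, column e Y q⟫_ℂ) ⟪X, Y⟫_ℂ := by
  have h := lp.hasSum_inner (𝕜 := ℂ) X Y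
  rw [← ((Equiv.prodComm b a).trans e.symm).hasSum_iff] at h
  exact h.prod_fiberwise fun q => lp.hasSum_inner (𝕜 := ℂ) (column e X q) (column e Y q)

lemma hasSum_norm_sq_column (e : κ ≃ a × b) (X : Ell2 κ) :
    HasSum (fun q => ‖column e X q‖ ^ 2) (‖X‖ ^ 2) := by
  have h := hasSum_norm_sq X
  rw [← ((Equiv.prodComm b a).trans e.symm).hasSum_iff] at h
  exact h.prod_fiberwise fun q => hasSum_norm_sq (column e X q)

variable (e : κ ≃ a × b) (M : Ell2 a →L[ℂ] Ell2 a)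

lemma norm_sq_map_column_le (X : Ell2 κ) (q : b) :
    ‖M (column e X q)‖ ^ 2 ≤ ‖M‖ ^ 2 * ‖column e X q‖ ^ 2 := by
  rw [← mul_pow]
  gcongr
  exact M.le_opNorm _

lemma memℓp_map_column (X : Ell2 κ) : Memℓp (fun k => M (column e X (e k).2) (e k).1) 2 := by
  refine memℓp_two_of_summable ?_
  rw [← ((Equiv.prodComm b a).trans e.symm).summable_iff]
  refine (summable_prod_of_nonneg fun _ => sq_nonneg _).2 ?_
  simp only [Equiv.trans_apply, Equiv.prodComm_apply, Prod.swap_prod_mk,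
    Equiv.apply_symm_apply, (hasSum_norm_sq _).tsum_eq]
  exact ⟨fun q => (hasSum_norm_sq _).summable, .of_nonneg_of_le (fun _ => by positivity)
    (norm_sq_map_column_le e M X) ((hasSum_norm_sq_column e X).summable.mul_left (‖M‖ ^ 2))⟩

/-- The linear map `M ⊗ 1` on `ℓ²(κ)`, where `κ ≃ a × b`. -/
def amplLinearMap : Ell2 κ →ₗ[ℂ] Ell2 κ where
  toFun X := ⟨fun k => M (column e X (e k).2) (e k).1, memℓp_map_column e M X⟩
  map_add' X Y := by
    ext k
    change M (column e (X + Y) (e k).2) (e k).1 = _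
    rw [column_add, map_add]
    rfl
  map_smul' c X := by
    ext k
    change M (column e (c • X) (e k).2) (e k).1 = _
    rw [column_smul, map_smul]
    rfl

lemma column_amplLinearMap (X : Ell2 κ) (q : b) :
    column e (amplLinearMap e M X) q = M (column e X q) := by
  ext x
  change M (column e X (e (e.symm (x, q))).2) (e (e.symm (x, q))).1 = _
  rw [e.apply_symm_apply]

lemma norm_amplLinearMap_le (X : Ell2 κ) : ‖amplLinearMap e M X‖ ≤ ‖M‖ * ‖X‖ := by
  refine le_of_sq_le_sq ?_ (by positivity)
  rw [mul_pow]
  refine hasSum_le (fun q => ?_) (hasSum_norm_sq_column e _)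
    ((hasSum_norm_sq_column e X).mul_left (‖M‖ ^ 2))
  rw [column_amplLinearMap]
  exact norm_sq_map_column_le e M X q

/-- The bounded operator `M ⊗ 1` on `ℓ²(κ)`, where `κ ≃ a × b`. -/
def ampl : Ell2 κ →L[ℂ] Ell2 κ :=
  (amplLinearMap e M).mkContinuous ‖M‖ (norm_amplLinearMap_le e M)

lemma ampl_apply (X : Ell2 κ) (k : κ) : ampl e M X k = M (column e X (e k).2) (e k).1 := rfl

lemma column_ampl (X : Ell2 κ) (q : b) : column e (ampl e M X) q = M (column e X q) :=
  column_amplLinearMap e M X q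

variable {M} in
lemma ampl_injective (hM : Function.Injective M) : Function.Injective (ampl e M) := fun X Y h =>
  ext_column (e := e) fun q => hM <| by rw [← column_ampl, ← column_ampl, h]

lemma ampl_apply_of_eq_mul {X : Ell2 κ} {k : κ} {c : ℂ} {w : Ell2 a}
    (h : ∀ x, X (e.symm (x, (e k).2)) = c * w x) : ampl e M X k = c * M w (e k).1 := by
  have hcolumn : column e X (e k).2 = c • w := by
    ext x
    exact h x
  rw [ampl_apply, hcolumn, map_smul]
  rfl

/-- The ampliation `M ↦ M ⊗ 1` as a homomorphism of star algebras. -/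
def amplHom : (Ell2 a →L[ℂ] Ell2 a) →⋆ₐ[ℂ] (Ell2 κ →L[ℂ] Ell2 κ) where
  toFun := ampl e
  map_one' := by ext X k; simp [ampl_apply, column_apply]
  map_mul' M N := by
    ext1 X
    exact ext_column (e := e) fun q => by simp [column_ampl]
  map_zero' := by ext X k; simp [ampl_apply]
  map_add' M N := by ext X k; simp [ampl_apply]
  commutes' c := by ext X k; simp [ampl_apply, column_apply, Algebra.algebraMap_eq_smul_one]
  map_star' M := by
    rw [ContinuousLinearMap.star_eq_adjoint, ContinuousLinearMap.star_eq_adjoint,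
      ContinuousLinearMap.eq_adjoint_iff]
    intro X Y
    have hleft := hasSum_inner_column e (ampl e M.adjoint X) Y
    have hright := hasSum_inner_column e X (ampl e M Y)
    simp only [column_ampl, ContinuousLinearMap.adjoint_inner_left] at hleft hright
    exact hleft.unique hright

lemma memℓp_mul (u : Ell2 a) (v : Ell2 b) : Memℓp (fun k => u (e k).1 * v (e k).2) 2 := by
  refine memℓp_two_of_summable ?_
  rw [← e.symm.summable_iff]
  refine ((hasSum_norm_sq u).summable.mul_of_nonneg (hasSum_norm_sq v).summable
    (fun _ => by positivity) fun _ => by positivity).congr fun k => ?_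
  simp [mul_pow]

/-- The rank-one family `u ⊗ v` on `κ ≃ a × b`. -/
def tens (u : Ell2 a) (v : Ell2 b) : Ell2 κ :=
  ⟨fun k => u (e k).1 * v (e k).2, memℓp_mul e u v⟩

lemma tens_apply (u : Ell2 a) (v : Ell2 b) (k : κ) : tens e u v k = u (e k).1 * v (e k).2 := rfl

lemma tens_trans_prodComm (u : Ell2 a) (v : Ell2 b) :
    tens (e.trans (Equiv.prodComm a b)) v u = tens e u v := by
  ext k
  exact mul_comm _ _

lemma ampl_tens (u : Ell2 a) (v : Ell2 b) : ampl e M (tens e u v) = tens e (M u) v := by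
  ext k
  rw [ampl_apply_of_eq_mul e M (c := v (e k).2) (w := u) fun x => ?_, tens_apply, mul_comm]
  rw [tens_apply, e.apply_symm_apply, mul_comm]

end Ampliation

section ModeOperators

variable {J : Type} [DecidableEq J] {κ : J → Type u}

/-- The operator `1 ⊗ ⋯ ⊗ M ⊗ ⋯ ⊗ 1` with `M` acting on the mode `j`, as a homomorphism of star
algebras in `M`. -/
def modeOp (j : J) : (Ell2 (κ j) →L[ℂ] Ell2 (κ j)) →⋆ₐ[ℂ]
    (Ell2 (∀ j, κ j) →L[ℂ] Ell2 (∀ j, κ j)) :=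
  amplHom (Equiv.piSplitAt j κ)

lemma modeOp_injective (j : J) {M : Ell2 (κ j) →L[ℂ] Ell2 (κ j)} (hM : Function.Injective M) :
    Function.Injective (modeOp j M) :=
  ampl_injective _ hM

lemma piSplitAt_symm_apply (j : J) (p : ∀ j, κ j) (x : κ j) :
    (Equiv.piSplitAt j κ).symm (x, (Equiv.piSplitAt j κ p).2) = Function.update p j x := by
  funext i
  rcases eq_or_ne i j with rfl | hij
  · simp
  · simp [hij]

lemma modeOp_apply_of_eq_mul {j : J} (M : Ell2 (κ j) →L[ℂ] Ell2 (κ j)) {X : Ell2 (∀ j, κ j)}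
    {p : ∀ j, κ j} {c : ℂ} {w : Ell2 (κ j)} (h : ∀ x, X (Function.update p j x) = c * w x) :
    modeOp j M X p = c * M w (p j) :=
  ampl_apply_of_eq_mul _ M fun x => by rw [piSplitAt_symm_apply, h]

lemma modeOp_apply (j : J) (M : Ell2 (κ j) →L[ℂ] Ell2 (κ j)) (X : Ell2 (∀ j, κ j))
    (p : ∀ j, κ j) :
    modeOp j M X p = M (column (Equiv.piSplitAt j κ) X (Equiv.piSplitAt j κ p).2) (p j) := rfl

lemma column_piSplitAt_apply (j : J) (X : Ell2 (∀ j, κ j)) (p : ∀ j, κ j) (x : κ j) :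
    column (Equiv.piSplitAt j κ) X (Equiv.piSplitAt j κ p).2 x = X (Function.update p j x) := by
  rw [column_apply, piSplitAt_symm_apply]

lemma modeOp_tens {P : J → Prop} {b : Type u} (e : (∀ i, κ i) ≃ (∀ i : {i // P i}, κ i) × b)
    {j : J} (hj : P j)
    (he : ∀ p x, e (Function.update p j x) = (Function.update (e p).1 ⟨j, hj⟩ x, (e p).2))
    (M : Ell2 (κ j) →L[ℂ] Ell2 (κ j)) (u : Ell2 (∀ i : {i // P i}, κ i)) (v : Ell2 b) :
    modeOp j M (tens e u v) =
      tens e (modeOp (κ := fun i : {i // P i} => κ i) ⟨j, hj⟩ M u) v := by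
  ext p
  have hp : (e p).1 ⟨j, hj⟩ = p j := by
    simpa using congrArg (fun q => q.1 ⟨j, hj⟩) (he p (p j))
  rw [tens_apply, modeOp_apply (κ := fun i : {i // P i} => κ i), mul_comm, hp]
  refine modeOp_apply_of_eq_mul M fun x => ?_
  rw [tens_apply, he, mul_comm, column_piSplitAt_apply]

end ModeOperators

section ElementaryTensors

variable {d : ℕ} {ι : Fin d → Type u}

lemma elem_apply (v : ∀ i, Ell2 (ι i)) (p : ∀ i, ι i) : elem v p = ∏ i, v i (p i) := rfl

lemma elem_update_apply (v : ∀ i, Ell2 (ι i)) (j : Fin d) (w : Ell2 (ι j)) (p : ∀ i, ι i) :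
    elem (Function.update v j w) p = (∏ i ∈ Finset.univ.erase j, v i (p i)) * w (p j) := by
  rw [elem_apply, ← Finset.prod_erase_mul _ _ (Finset.mem_univ j), Function.update_self]
  congr 1
  refine Finset.prod_congr rfl fun i hi => ?_
  rw [Function.update_of_ne (Finset.ne_of_mem_erase hi)]

lemma elem_update_smul (v : ∀ i, Ell2 (ι i)) (j : Fin d) (c : ℂ) (w : Ell2 (ι j)) :
    elem (Function.update v j (c • w)) = c • elem (Function.update v j w) := by
  ext p
  simp only [elem_update_apply, lp.coeFn_smul, Pi.smul_apply, smul_eq_mul, mul_left_comm]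

lemma modeOp_elem (j : Fin d) (M : Ell2 (ι j) →L[ℂ] Ell2 (ι j)) (v : ∀ i, Ell2 (ι i)) :
    modeOp j M (elem v) = elem (Function.update v j (M (v j))) := by
  ext p
  rw [elem_update_apply]
  refine modeOp_apply_of_eq_mul M fun x => ?_
  rw [elem_apply, ← Finset.prod_erase_mul _ _ (Finset.mem_univ j), Function.update_self]
  congr 1
  refine Finset.prod_congr rfl fun i hi => ?_
  rw [Function.update_of_ne (Finset.ne_of_mem_erase hi)]

open Classical in
lemma single_eq_smul_elem (p : ∀ i, ι i) (c : ℂ) :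
    (lp.single 2 p c : Tensor ι) = c • elem fun i => lp.single 2 (p i) 1 := by
  ext q
  rw [lp.coeFn_smul, Pi.smul_apply, elem_apply, smul_eq_mul]
  by_cases hq : q = p
  · simp [hq]
  · obtain ⟨i, hi⟩ := Function.ne_iff.1 hq
    rw [Finset.prod_eq_zero (Finset.mem_univ i) (lp.single_apply_ne 2 _ _ hi), mul_zero,
      lp.single_apply_ne 2 _ _ hq]

lemma dense_span_elem : Dense (Submodule.span ℂ (Set.range (elem (ι := ι))) : Set (Tensor ι)) := by
  classical
  intro X
  refine mem_closure_of_tendsto (lp.hasSum_single (p := 2) ENNReal.ofNat_ne_top X)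
    (.of_forall fun s => Submodule.sum_mem _ fun p _ => ?_)
  rw [single_eq_smul_elem]
  exact Submodule.smul_mem _ _ (Submodule.subset_span ⟨_, rfl⟩)

lemma clm_ext_elem {F : Type*} [NormedAddCommGroup F] [NormedSpace ℂ F]
    {S T : Tensor ι →L[ℂ] F} (h : ∀ v, S (elem v) = T (elem v)) : S = T :=
  ContinuousLinearMap.ext_on dense_span_elem (Set.forall_mem_range.2 h)

lemma commute_modeOp_of_ne {i j : Fin d} (hij : i ≠ j) (M : Ell2 (ι i) →L[ℂ] Ell2 (ι i))
    (N : Ell2 (ι j) →L[ℂ] Ell2 (ι j)) : Commute (modeOp i M) (modeOp j N) := by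
  refine clm_ext_elem fun v => ?_
  change modeOp i M (modeOp j N (elem v)) = modeOp j N (modeOp i M (elem v))
  rw [modeOp_elem, modeOp_elem, modeOp_elem, modeOp_elem, Function.update_of_ne hij,
    Function.update_of_ne hij.symm, Function.update_comm hij]

lemma commute_modeOp (M : ∀ i, Ell2 (ι i) →L[ℂ] Ell2 (ι i)) (i j : Fin d) :
    Commute (modeOp i (M i)) (modeOp j (M j)) := by
  rcases eq_or_ne i j with rfl | hij
  · exact Commute.refl _
  · exact commute_modeOp_of_ne hij _ _

/-- The tensor product `M₁ ⊗ ⋯ ⊗ M_d` of operators, as the product of the operators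
`1 ⊗ ⋯ ⊗ M_i ⊗ ⋯ ⊗ 1`. -/
def kroneckerProd (M : ∀ i, Ell2 (ι i) →L[ℂ] Ell2 (ι i)) : Tensor ι →L[ℂ] Tensor ι :=
  (List.ofFn fun i => modeOp i (M i)).prod

lemma prod_map_modeOp_elem (M : ∀ i, Ell2 (ι i) →L[ℂ] Ell2 (ι i)) (v : ∀ i, Ell2 (ι i))
    {l : List (Fin d)} (hl : l.Nodup) :
    (l.map fun i => modeOp i (M i)).prod (elem v) =
      elem fun i => if i ∈ l then M i (v i) else v i := by
  induction l with
  | nil => simp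
  | cons j l ih =>
    rw [List.nodup_cons] at hl
    rw [List.map_cons, List.prod_cons, mul_apply_eq_comp, ih hl.2, modeOp_elem]
    congr 1
    funext i
    rcases eq_or_ne i j with rfl | hij
    · simp [hl.1]
    · simp [hij]

lemma kroneckerProd_elem (M : ∀ i, Ell2 (ι i) →L[ℂ] Ell2 (ι i)) (v : ∀ i, Ell2 (ι i)) :
    kroneckerProd M (elem v) = elem fun i => M i (v i) := by
  simpa [kroneckerProd, List.ofFn_eq_map] using prod_map_modeOp_elem M v (List.nodup_finRange d)

lemma injective_list_prod {R E : Type*} [Semiring R] [AddCommMonoid E] [Module R E]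
    [TopologicalSpace E] (l : List (E →L[R] E)) (hl : ∀ T ∈ l, Function.Injective T) :
    Function.Injective l.prod := by
  induction l with
  | nil => exact Function.injective_id
  | cons T l ih =>
    rw [List.prod_cons]
    exact (hl T List.mem_cons_self).comp (ih fun S hS => hl S (List.mem_cons_of_mem _ hS))

lemma kroneckerProd_injective {M : ∀ i, Ell2 (ι i) →L[ℂ] Ell2 (ι i)}
    (hM : ∀ i, Function.Injective (M i)) : Function.Injective (kroneckerProd M) :=
  injective_list_prod _ <| List.forall_mem_ofFn_iff.2 fun i => modeOp_injective i (hM i)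

lemma isLeftRegular_of_injective {R E : Type*} [Semiring R] [AddCommMonoid E] [Module R E]
    [TopologicalSpace E] {T : E →L[R] E} (hT : Function.Injective T) : IsLeftRegular T :=
  fun _ _ h => ContinuousLinearMap.ext fun x => hT (congrArg (fun U : E →L[R] E => U x) h)

end ElementaryTensors

section InverseOfKroneckerSum

lemma graph_toLinearPMap_of_isBoundedInverse {H : Type u} [NormedAddCommGroup H]
    [InnerProductSpace ℂ H] [CompleteSpace H] {g : Submodule ℂ (H × H)} {B : H →L[ℂ] H}
    (hB : IsBoundedInverse g.toLinearPMap B) : g.toLinearPMap.graph = g := by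
  classical
  by_cases hg : ∀ (x : H × H) (_ : x ∈ g) (_ : x.fst = 0), x.snd = 0
  · exact Submodule.toLinearPMap_graph_eq g hg
  · -- otherwise `g.toLinearPMap` is the junk value `0`, which is invertible only if `H` is trivial
    refine absurd (fun x _ _ => ?_) hg
    obtain ⟨h, hx⟩ := hB.1 x.2
    rw [← hx]
    change (if hg : _ then g.toLinearPMapAux hg else 0) _ = _
    rw [dif_neg hg]
    rfl

lemma IsInvertible.isBoundedInverse_boundedInverse {H : Type u} [NormedAddCommGroup H]
    [InnerProductSpace ℂ H] [CompleteSpace H] {T : H →ₗ.[ℂ] H} (hT : IsInvertible T) :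
    IsBoundedInverse T (boundedInverse T) := by
  rw [boundedInverse, dif_pos hT]
  exact hT.choose_spec

variable {d : ℕ} {ι : Fin d → Type u} {A : ∀ i, Ell2 (ι i) →ₗ.[ℂ] Ell2 (ι i)}
  {B : Tensor ι →L[ℂ] Tensor ι} {R : ∀ i, Ell2 (ι i) →L[ℂ] Ell2 (ι i)}

lemma IsBoundedInverse.apply_eq_of_mem_closure (hB : IsBoundedInverse (kroneckerSum A) B)
    {x z : Tensor ι} (h : (x, z) ∈ (algKroneckerGraph A).topologicalClosure) : B z = x := by
  rw [← graph_toLinearPMap_of_isBoundedInverse hB] at h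
  obtain ⟨y, rfl, rfl⟩ := (LinearPMap.mem_graph_iff _).1 h
  exact hB.2 y

lemma IsBoundedInverse.mem_closure (hB : IsBoundedInverse (kroneckerSum A) B) (z : Tensor ι) :
    (B z, z) ∈ (algKroneckerGraph A).topologicalClosure := by
  obtain ⟨h, hz⟩ := hB.1 z
  rw [← graph_toLinearPMap_of_isBoundedInverse hB]
  exact (LinearPMap.mem_graph_iff _).2 ⟨⟨B z, h⟩, rfl, hz⟩

lemma IsBoundedInverse.pos (hB : IsBoundedInverse (kroneckerSum A) B) : 0 < d := by
  by_contra! hd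
  obtain rfl := Nat.le_zero.1 hd
  have hmem : ((elem fun i => i.elim0 : Tensor ι), (0 : Tensor ι)) ∈ algKroneckerGraph A :=
    Submodule.subset_span ⟨fun i => i.elim0,
      Prod.ext (congrArg elem (funext fun i => i.elim0)) (by simp)⟩
  have hzero := hB.apply_eq_of_mem_closure (subset_closure hmem)
  rw [map_zero] at hzero
  simpa [elem_apply] using congrArg (fun X : Tensor ι => X fun i => i.elim0) hzero

lemma IsResolvent.commute_apply {H : Type u} [NormedAddCommGroup H] [InnerProductSpace ℂ H]
    {A : H →ₗ.[ℂ] H} {R : H →L[ℂ] H} (hR : IsResolvent A R) (v : A.domain) :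
    A ⟨R v, hR.mem_domain v⟩ = R (A v) := by
  rw [hR.apply_eq, sub_eq_iff_eq_add', ← map_add, hR.map_add_apply]

lemma modeOp_generator_mem_algKroneckerGraph (hR : ∀ i, IsResolvent (A i) (R i)) (i : Fin d)
    (v : ∀ i, (A i).domain) :
    (modeOp i (R i) (elem fun k => (v k : Ell2 (ι k))), modeOp i (R i)
      (∑ j, elem (Function.update (fun k => (v k : Ell2 (ι k))) j (A j (v j))))) ∈
        algKroneckerGraph A := by
  set v' : ∀ k, (A k).domain := Function.update v i ⟨R i (v i), (hR i).mem_domain _⟩ with hv'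
  have hcoe : (fun k => (v' k : Ell2 (ι k))) =
      Function.update (fun k => (v k : Ell2 (ι k))) i (R i (v i)) := by
    funext k
    rcases eq_or_ne k i with rfl | hk
    · simp [hv']
    · simp [hv', hk]
  refine Submodule.subset_span ⟨v', Prod.ext ?_ ?_⟩
  · simp only [modeOp_elem]
    rw [hcoe]
  · simp only [map_sum, modeOp_elem]
    refine Finset.sum_congr rfl fun j _ => ?_
    rw [hcoe]
    rcases eq_or_ne j i with rfl | hj
    · have hval : A j (v' j) = R j (A j (v j)) := by
        rw [hv', Function.update_self, (hR j).commute_apply]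
      rw [hval, Function.update_idem, Function.update_idem, Function.update_self]
    · have hval : v' j = v j := Function.update_of_ne hj _ _
      rw [hval, Function.update_comm hj, Function.update_of_ne hj.symm]

lemma modeOp_mem_algKroneckerGraph (hR : ∀ i, IsResolvent (A i) (R i)) (i : Fin d)
    {x : Tensor ι × Tensor ι} (hx : x ∈ algKroneckerGraph A) :
    (modeOp i (R i) x.1, modeOp i (R i) x.2) ∈ algKroneckerGraph A := by
  let T := (modeOp i (R i) : Tensor ι →ₗ[ℂ] Tensor ι)
  have hle : algKroneckerGraph A ≤ (algKroneckerGraph A).comap (T.prodMap T) :=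
    Submodule.span_le.2 <| Set.range_subset_iff.2 (modeOp_generator_mem_algKroneckerGraph hR i)
  exact hle hx

lemma IsBoundedInverse.commute_modeOp_resolvent (hB : IsBoundedInverse (kroneckerSum A) B)
    (hR : ∀ i, IsResolvent (A i) (R i)) (i : Fin d) : Commute B (modeOp i (R i)) := by
  ext1 z
  refine hB.apply_eq_of_mem_closure ?_
  exact map_mem_closure (f := fun x : Tensor ι × Tensor ι =>
    (modeOp i (R i) x.1, modeOp i (R i) x.2)) (by fun_prop) (hB.mem_closure z)
    fun x hx => modeOp_mem_algKroneckerGraph hR i hx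

lemma prod_update_modeOp (R : ∀ i, Ell2 (ι i) →L[ℂ] Ell2 (ι i)) (j : Fin d) :
    (List.ofFn (Function.update (fun i => modeOp i (R i)) j (1 - modeOp j (R j)))).prod =
      kroneckerProd (Function.update R j (1 - R j)) := by
  rw [kroneckerProd]
  congr 2
  funext i
  rcases eq_or_ne i j with rfl | hij
  · simp
  · simp [hij]

/- On `u₁ ⊗ ⋯ ⊗ u_d` this says that `𝒜` maps `R₁ u₁ ⊗ ⋯ ⊗ R_d u_d` to
`∑ j, R₁ u₁ ⊗ ⋯ ⊗ (1 - R_j) u_j ⊗ ⋯ ⊗ R_d u_d`, because `A_j R_j = 1 - R_j`. -/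
lemma IsBoundedInverse.mul_sum_prod_update_modeOp (hB : IsBoundedInverse (kroneckerSum A) B)
    (hR : ∀ i, IsResolvent (A i) (R i)) :
    B * ∑ j, (List.ofFn (Function.update (fun i => modeOp i (R i)) j
      (1 - modeOp j (R j)))).prod = kroneckerProd R := by
  refine clm_ext_elem fun u => ?_
  rw [mul_apply_eq_comp, kroneckerProd_elem, sum_apply]
  refine hB.apply_eq_of_mem_closure <| subset_closure <| Submodule.subset_span
    ⟨fun i => ⟨R i (u i), (hR i).mem_domain _⟩, Prod.ext rfl ?_⟩
  dsimp only
  refine Finset.sum_congr rfl fun j _ => ?_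
  rw [prod_update_modeOp, kroneckerProd_elem, (hR j).apply_eq]
  congr 1
  funext i
  rcases eq_or_ne i j with rfl | hij
  · simp
  · simp [hij]

/- The factor `exp t • expNegInv t (R i)` is `exp (-t A_i)`, because `(R i)⁻¹ = 1 + A_i`. -/
theorem IsBoundedInverse.nonneg_and_expNegInv_eq_kroneckerProd
    (hB : IsBoundedInverse (kroneckerSum A) B) (hA : ∀ i, IsPSD (A i))
    (hR : ∀ i, IsResolvent (A i) (R i)) :
    0 ≤ B ∧ ∀ t : ℝ, 0 < t →
      expNegInv t B = kroneckerProd fun i => Real.exp t • expNegInv t (R i) := by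
  obtain ⟨hnonneg, hexp⟩ := nonneg_and_prod_expNegInv (r := fun i => modeOp i (R i))
    (fun i => map_nonneg (modeOp i) ((hR i).nonneg (hA i)))
    (fun i => (OrderHomClass.mono (modeOp i) ((hR i).le_one (hA i))).trans_eq (map_one _))
    (commute_modeOp R)
    (isLeftRegular_of_injective (kroneckerProd_injective fun i => (hR i).injective))
    (hB.commute_modeOp_resolvent hR) (hB.mul_sum_prod_update_modeOp hR)
  refine ⟨hnonneg, fun t ht => (hexp t ht).symm.trans ?_⟩
  rw [kroneckerProd]
  congr 2
  funext i
  rw [map_real_smul _ (map_continuous (modeOp i)),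
    map_expNegInv _ t ((hR i).isSelfAdjoint (hA i))]
  rfl

end InverseOfKroneckerSum

section SumOf

variable {E : Type*} [AddCommMonoid E] {S : Set E} {r s : ℕ} {X Y : E}

/-- `X` is a sum of at most `r` elements of `S`: the rank of `X` with respect to the simple
tensors `S` is at most `r`. -/
def IsSumOf (S : Set E) (r : ℕ) (X : E) : Prop :=
  ∃ l : List E, l.length ≤ r ∧ (∀ x ∈ l, x ∈ S) ∧ l.sum = X

lemma IsSumOf.mono (h : IsSumOf S r X) (hrs : r ≤ s) : IsSumOf S s X := by
  obtain ⟨l, hl, hlS, rfl⟩ := h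
  exact ⟨l, hl.trans hrs, hlS, rfl⟩

lemma IsSumOf.map {F : Type*} [FunLike F E E] [AddMonoidHomClass F E E] (h : IsSumOf S r X) (T : F)
    (hT : Set.MapsTo T S S) : IsSumOf S r (T X) := by
  obtain ⟨l, hl, hlS, rfl⟩ := h
  exact ⟨l.map T, by rwa [List.length_map], List.forall_mem_map.2 fun x hx => hT (hlS x hx),
    (map_list_sum T l).symm⟩

lemma IsSumOf.add (hX : IsSumOf S r X) (hY : IsSumOf S s Y) : IsSumOf S (r + s) (X + Y) := by
  obtain ⟨l, hl, hlS, rfl⟩ := hX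
  obtain ⟨m, hm, hmS, rfl⟩ := hY
  exact ⟨l ++ m, List.length_append.trans_le (add_le_add hl hm),
    List.forall_mem_append.2 ⟨hlS, hmS⟩, List.sum_append⟩

lemma IsSumOf.sum_range {X : ℕ → E} (hX : ∀ k, IsSumOf S r (X k)) (N : ℕ) :
    IsSumOf S (N * r) (∑ k ∈ Finset.range N, X k) := by
  induction N with
  | zero => exact ⟨[], by simp, by simp, rfl⟩
  | succ N ih =>
    rw [Finset.sum_range_succ, Nat.succ_mul]
    exact ih.add (hX N)

lemma isSumOf_sum {x : Fin r → E} (hx : ∀ i, x i ∈ S) : IsSumOf S r (∑ i, x i) :=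
  ⟨List.ofFn x, List.length_ofFn.le, List.forall_mem_ofFn_iff.2 hx, List.sum_ofFn⟩

end SumOf

section RankOne

variable {κ a b : Type u} {e : κ ≃ a × b} {X : Ell2 κ} {r : ℕ}

/-- The families `u ⊗ v` on `κ ≃ a × b`, whose matrices have rank at most one. -/
def rankOne (e : κ ≃ a × b) : Set (Ell2 κ) := Set.range fun w : Ell2 a × Ell2 b => tens e w.1 w.2

/-- The matrix of a family indexed by `κ ≃ a × b`. -/
def unfolding (e : κ ≃ a × b) (X : Ell2 κ) : Matrix a b ℂ := fun x q => X (e.symm (x, q))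

lemma cRank_unfolding (e : κ ≃ a × b) (X : Ell2 κ) :
    (unfolding e X).cRank = Module.rank ℂ (Submodule.span ℂ (Set.range (column e X))) := by
  let coe : Ell2 a →ₗ[ℂ] (a → ℂ) :=
    { toFun := fun v => v, map_add' := fun _ _ => rfl, map_smul' := fun _ _ => rfl }
  have hcoe : Function.Injective coe := fun v w h => lp.ext h
  rw [(Submodule.equivMapOfInjective coe hcoe _).rank_eq, Submodule.map_span, ← Set.range_comp]
  rfl

lemma memℓp_inner_column (e : κ ≃ a × b) (X : Ell2 κ) (u : Ell2 a) :
    Memℓp (fun q => ⟪u, column e X q⟫_ℂ) 2 := by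
  refine memℓp_two_of_summable (.of_nonneg_of_le (fun _ => by positivity) (fun q => ?_)
    ((hasSum_norm_sq_column e X).summable.mul_left (‖u‖ ^ 2)))
  rw [← mul_pow]
  gcongr
  exact norm_inner_le_norm u _

lemma isSumOf_rankOne_finrank {V : Submodule ℂ (Ell2 a)} [FiniteDimensional ℂ V]
    (hV : ∀ q, column e X q ∈ V) : IsSumOf (rankOne e) (Module.finrank ℂ V) X := by
  let u := stdOrthonormalBasis ℂ V
  let v (s : Fin (Module.finrank ℂ V)) : Ell2 b :=
    ⟨fun q => ⟪(u s : Ell2 a), column e X q⟫_ℂ, memℓp_inner_column e X (u s)⟩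
  have hX : X = ∑ s, tens e (u s : Ell2 a) (v s) := by
    refine ext_column (e := e) fun q => ?_
    have hsum := congrArg V.subtype (u.sum_repr' ⟨column e X q, hV q⟩)
    rw [map_sum] at hsum
    refine hsum.symm.trans (lp.ext (funext fun x => ?_))
    simp only [column_apply, lp.coeFn_sum, Finset.sum_apply, tens_apply, e.apply_symm_apply]
    exact Finset.sum_congr rfl fun s _ => mul_comm _ _
  rw [hX]
  exact isSumOf_sum fun s => ⟨(u s, v s), rfl⟩

lemma isSumOf_rankOne_of_eRank_le (h : (unfolding e X).eRank ≤ r) : IsSumOf (rankOne e) r X := by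
  rw [Matrix.eRank, Cardinal.toENat_le_natCast, cRank_unfolding] at h
  have : FiniteDimensional ℂ (Submodule.span ℂ (Set.range (column e X))) :=
    Module.rank_lt_aleph0_iff.1 (h.trans_lt Cardinal.natCast_lt_aleph0)
  exact (isSumOf_rankOne_finrank fun q => Submodule.subset_span (Set.mem_range_self q)).mono
    (Module.finrank_le_of_rank_le h)

lemma exists_finset_column_sum_mem_span (l : List (Ell2 κ)) (hl : ∀ Y ∈ l, Y ∈ rankOne e) :
    ∃ s : Finset (Ell2 a), s.card ≤ l.length ∧
      ∀ q, column e l.sum q ∈ Submodule.span ℂ (s : Set (Ell2 a)) := by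
  classical
  induction l with
  | nil => exact ⟨∅, le_rfl, fun _ => Submodule.zero_mem _⟩
  | cons Y l ih =>
    rw [List.forall_mem_cons] at hl
    obtain ⟨⟨u, v⟩, rfl⟩ := hl.1
    obtain ⟨s, hs, hmem⟩ := ih hl.2
    refine ⟨insert u s, (Finset.card_insert_le u s).trans (Nat.succ_le_succ hs), fun q => ?_⟩
    have hcol : column e (tens e u v) q = v q • u := by
      ext x
      simp only [column_apply, tens_apply, e.apply_symm_apply, lp.coeFn_smul, Pi.smul_apply,
        smul_eq_mul, mul_comm]
    rw [List.sum_cons, column_add, hcol, Finset.coe_insert]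
    exact add_mem (Submodule.smul_mem _ _ (Submodule.subset_span (Set.mem_insert _ _)))
      (Submodule.span_mono (Set.subset_insert _ _) (hmem q))

lemma eRank_unfolding_le_iff : (unfolding e X).eRank ≤ r ↔ IsSumOf (rankOne e) r X := by
  refine ⟨isSumOf_rankOne_of_eRank_le, ?_⟩
  rintro ⟨l, hl, hmem, rfl⟩
  obtain ⟨s, hs, hspan⟩ := exists_finset_column_sum_mem_span l hmem
  rw [Matrix.eRank, Cardinal.toENat_le_natCast, cRank_unfolding]
  calc Module.rank ℂ (Submodule.span ℂ (Set.range (column e l.sum)))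
      ≤ Module.rank ℂ (Submodule.span ℂ (s : Set (Ell2 a))) :=
        Submodule.rank_mono (Submodule.span_le.2 (Set.range_subset_iff.2 hspan))
    _ ≤ s.card := rank_span_finset_le s
    _ ≤ r := by exact_mod_cast hs.trans hl

end RankOne

section TensorRanks

variable {d : ℕ} {ι : Fin d → Type u} {X : Tensor ι} {r : ℕ}

lemma cpRank_le_iff : cpRank X ≤ r ↔ IsSumOf (Set.range (elem (ι := ι))) r X := by
  constructor
  · intro h
    obtain ⟨k, hk⟩ := iInf_lt_iff.1 (h.trans_lt (Nat.cast_lt.2 r.lt_succ_self))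
    obtain ⟨⟨v, rfl⟩, hkr⟩ := iInf_lt_iff.1 hk
    exact (isSumOf_sum fun s => Set.mem_range_self (v s)).mono
      (Nat.lt_succ_iff.1 (Nat.cast_lt.1 hkr))
  · rintro ⟨l, hl, hmem, rfl⟩
    choose v hv using fun s : Fin l.length => hmem _ (l.get_mem s)
    refine (iInf₂_le l.length ⟨v, ?_⟩).trans (Nat.cast_le.2 hl)
    simp only [hv, ← List.sum_ofFn, List.ofFn_get]

lemma multilinearRank_le_iff {i : Fin d} :
    multilinearRank X i ≤ r ↔ IsSumOf (rankOne (Equiv.piSplitAt i ι)) r X :=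
  eRank_unfolding_le_iff

lemma ttRank_le_iff {k : Fin (d - 1)} : ttRank X k ≤ r ↔
    IsSumOf (rankOne (Equiv.piEquivPiSubtypeProd (fun j : Fin d => j.val < k.val + 1) ι)) r X :=
  eRank_unfolding_le_iff

/-- A set of tensors that is stable under scalars and under operators acting on a single mode. -/
structure IsModeStable (S : Set (Tensor ι)) : Prop where
  smul_mem : ∀ (c : ℝ), ∀ Y ∈ S, c • Y ∈ S
  modeOp_mem : ∀ (j : Fin d) (M : Ell2 (ι j) →L[ℂ] Ell2 (ι j)), ∀ Y ∈ S, modeOp j M Y ∈ S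

lemma IsModeStable.kroneckerProd_mem {S : Set (Tensor ι)} (hS : IsModeStable S)
    (M : ∀ i, Ell2 (ι i) →L[ℂ] Ell2 (ι i)) {Y : Tensor ι} (hY : Y ∈ S) : kroneckerProd M Y ∈ S := by
  rw [kroneckerProd, List.ofFn_eq_map]
  induction List.finRange d with
  | nil => exact hY
  | cons i l ih =>
    rw [List.map_cons, List.prod_cons, mul_apply_eq_comp]
    exact hS.modeOp_mem i (M i) _ ih

lemma IsModeStable.isSumOf_sum_smul_kroneckerProd {S : Set (Tensor ι)} (hS : IsModeStable S)
    (N : ℕ) (w : ℕ → ℝ) (M : ℕ → ∀ i, Ell2 (ι i) →L[ℂ] Ell2 (ι i)) (hX : IsSumOf S r X) :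
    IsSumOf S (N * r) (∑ k ∈ Finset.range N, w k • kroneckerProd (M k) X) :=
  IsSumOf.sum_range (fun k => hX.map (w k • kroneckerProd (M k)) fun _ hY =>
    hS.smul_mem (w k) _ (hS.kroneckerProd_mem (M k) hY)) N

lemma isModeStable_range_elem (j : Fin d) : IsModeStable (Set.range (elem (ι := ι))) where
  smul_mem := by
    rintro c _ ⟨v, rfl⟩
    refine ⟨Function.update v j ((c : ℂ) • v j), ?_⟩
    rw [elem_update_smul, Function.update_eq_self]
    rfl
  modeOp_mem := by
    rintro i M _ ⟨v, rfl⟩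
    exact ⟨_, (modeOp_elem i M v).symm⟩

lemma smul_tens {κ a b : Type u} (e : κ ≃ a × b) (c : ℝ) (u : Ell2 a) (v : Ell2 b) :
    c • tens e u v = tens e (c • u) v := by
  ext k
  exact (smul_mul_assoc c (u (e k).1) (v (e k).2)).symm

lemma isModeStable_rankOne_piSplitAt (i : Fin d) :
    IsModeStable (rankOne (Equiv.piSplitAt i ι)) where
  smul_mem := by
    rintro c _ ⟨⟨u, v⟩, rfl⟩
    exact ⟨(c • u, v), (smul_tens _ c u v).symm⟩
  modeOp_mem := by
    rintro j M _ ⟨⟨u, v⟩, rfl⟩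
    rcases eq_or_ne j i with rfl | hj
    · exact ⟨(M u, v), (ampl_tens _ M u v).symm⟩
    · refine ⟨(u, modeOp (κ := fun k : {k // k ≠ i} => ι k) ⟨j, hj⟩ M v), ?_⟩
      simp only [← tens_trans_prodComm (Equiv.piSplitAt i ι)]
      exact (modeOp_tens (P := fun k => k ≠ i) _ hj (fun p x => Prod.ext
        (Function.update_comp_eq_of_injective' p Subtype.val_injective ⟨j, hj⟩ x)
        (Function.update_of_ne hj.symm x p)) M v u).symm

lemma isModeStable_rankOne_piEquivPiSubtypeProd (P : Fin d → Prop) [DecidablePred P] :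
    IsModeStable (rankOne (Equiv.piEquivPiSubtypeProd P ι)) where
  smul_mem := by
    rintro c _ ⟨⟨u, v⟩, rfl⟩
    exact ⟨(c • u, v), (smul_tens _ c u v).symm⟩
  modeOp_mem := by
    rintro j M _ ⟨⟨u, v⟩, rfl⟩
    by_cases hj : P j
    · refine ⟨(modeOp (κ := fun k : {k // P k} => ι k) ⟨j, hj⟩ M u, v), ?_⟩
      exact (modeOp_tens _ hj (fun p x => Prod.ext
        (Function.update_comp_eq_of_injective' p Subtype.val_injective ⟨j, hj⟩ x)
        (Function.update_comp_eq_of_forall_ne' p x fun k hk => k.2 (hk ▸ hj))) M u v).symm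
    · refine ⟨(u, modeOp (κ := fun k : {k // ¬ P k} => ι k) ⟨j, hj⟩ M v), ?_⟩
      simp only [← tens_trans_prodComm (Equiv.piEquivPiSubtypeProd P ι)]
      exact (modeOp_tens (P := fun k => ¬ P k) _ hj (fun p x => Prod.ext
        (Function.update_comp_eq_of_injective' p Subtype.val_injective ⟨j, hj⟩ x)
        (Function.update_comp_eq_of_forall_ne' p x fun k hk => hj (hk ▸ k.2))) M v u).symm

end TensorRanks

section Approximation

variable {d : ℕ} {ι : Fin d → Type u} {A : ∀ i, Ell2 (ι i) →ₗ.[ℂ] Ell2 (ι i)}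

lemma exists_norm_negPow_sub_sum_smul_kroneckerProd_le (hA : ∀ i, IsPSD (A i))
    (hinv : IsInvertible (kroneckerSum A)) {α : ℝ} (hα : 0 < α) {N : ℕ} {w t : ℕ → ℝ}
    (ht : ∀ k, 0 < t k) {ε : ℝ} (hε : 0 ≤ ε)
    (h : ∀ x ∈ Set.Icc 0 ‖boundedInverse (kroneckerSum A)‖,
      |x ^ α - ∑ k ∈ Finset.range N, w k * expNegDiv (t k) x| ≤ ε) :
    ∃ M : ℕ → ∀ i, Ell2 (ι i) →L[ℂ] Ell2 (ι i),
      ‖negPow (kroneckerSum A) α - ∑ k ∈ Finset.range N, w k • kroneckerProd (M k)‖ ≤ ε := by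
  choose R hR using fun i => (hA i).exists_isResolvent
  obtain ⟨hnonneg, hexp⟩ :=
    hinv.isBoundedInverse_boundedInverse.nonneg_and_expNegInv_eq_kroneckerProd hA hR
  refine ⟨fun k i => Real.exp (t k) • expNegInv (t k) (R i), ?_⟩
  simp only [← hexp _ (ht _)]
  exact norm_rpow_sub_sum_smul_expNegInv_le hnonneg hα hε h

end Approximation

end FracKron

end

open FracKron in
theorem theorem3p6_general (α : ℝ) (hα : 0 < α) :
    ∃ K : ℝ, 0 < K ∧
      ∀ (d : ℕ) (ι : Fin d → Type u) (A : ∀ i, Ell2 (ι i) →ₗ.[ℂ] Ell2 (ι i)),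
        (∀ i, IsPSD (A i)) → IsInvertible (kroneckerSum A) →
        ∀ C X : Tensor ι, X = negPow (kroneckerSum A) α C →
        ∀ N : ℕ, ∃ XN : Tensor ι,
          ‖X - XN‖ ≤ K * ‖boundedInverse (kroneckerSum A)‖ ^ α * ‖C‖ *
            Real.exp (-(Real.pi / 2) * Real.sqrt (α * N)) ∧
          (∀ r : ℕ, cpRank C ≤ r → cpRank XN ≤ (N * r : ℕ)) ∧
          (∀ r : Fin d → ℕ, (∀ i, multilinearRank C i ≤ r i) →
            ∀ i, multilinearRank XN i ≤ (N * r i : ℕ)) ∧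
          (∀ r : Fin (d - 1) → ℕ, (∀ k, ttRank C k ≤ r k) →
            ∀ k, ttRank XN k ≤ (N * r k : ℕ)) := by
  obtain ⟨K, hK, happrox⟩ := exists_sum_expNegDiv_approx_rpow hα
  refine ⟨K, hK, fun d ι A hA hinv C X hX N => ?_⟩
  obtain ⟨w, t, ht, hwt⟩ := happrox ‖boundedInverse (kroneckerSum A)‖ (norm_nonneg _) N
  obtain ⟨M, hM⟩ :=
    exists_norm_negPow_sub_sum_smul_kroneckerProd_le hA hinv hα ht (by positivity) hwt
  have hrank {S : Set (Tensor ι)} (hS : IsModeStable S) {r : ℕ} (hC : IsSumOf S r C) :=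
    hS.isSumOf_sum_smul_kroneckerProd N w M hC
  refine ⟨∑ k ∈ Finset.range N, w k • kroneckerProd (M k) C, ?_, fun r hC => ?_,
    fun r hC i => ?_, fun r hC k => ?_⟩
  · have herr := ContinuousLinearMap.le_of_opNorm_le _ hM C
    rw [sub_apply, sum_apply, ← hX] at herr
    exact herr.trans_eq (mul_right_comm ..)
  · have hd : 0 < d := hinv.isBoundedInverse_boundedInverse.pos
    exact cpRank_le_iff.2 (hrank (isModeStable_range_elem ⟨0, hd⟩) (cpRank_le_iff.1 hC))
  · exact multilinearRank_le_iff.2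
      (hrank (isModeStable_rankOne_piSplitAt i) (multilinearRank_le_iff.1 (hC i)))
  · exact ttRank_le_iff.2
      (hrank (isModeStable_rankOne_piEquivPiSubtypeProd _) (ttRank_le_iff.1 (hC k)))

open FracKron in
theorem theorem3p6 (α : ℝ) (hα₀ : 0 < α) (hα₁ : α < 1) :
    ∃ K : ℝ, 0 < K ∧
      ∀ (d : ℕ) (ι : Fin d → Type u) (A : ∀ i, Ell2 (ι i) →ₗ.[ℂ] Ell2 (ι i)),
        (∀ i, IsSPD (A i)) → IsInvertible (kroneckerSum A) →
        ∀ C X : Tensor ι, X = negPow (kroneckerSum A) α C →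
        ∀ N : ℕ, ∃ XN : Tensor ι,
          ‖X - XN‖ ≤ K * ‖boundedInverse (kroneckerSum A)‖ ^ α * ‖C‖ *
            Real.exp (-(Real.pi / 2) * Real.sqrt (α * N)) ∧
          (∀ r : ℕ, cpRank C ≤ r → cpRank XN ≤ (N * r : ℕ)) ∧
          (∀ r : Fin d → ℕ, (∀ i, multilinearRank C i ≤ r i) →
            ∀ i, multilinearRank XN i ≤ (N * r i : ℕ)) ∧
          (∀ r : Fin (d - 1) → ℕ, (∀ k, ttRank C k ≤ r k) →
            ∀ k, ttRank XN k ≤ (N * r k : ℕ)) := by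
  obtain ⟨K, hK, h⟩ := theorem3p6_general α hα₀
  exact ⟨K, hK, fun d ι A hA => h d ι A fun i => (hA i).isPSD⟩
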